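/- Let $Q=(q_{ij})_{i,j=1}^d$ be the transition rate matrix of an irreducible continuous-time Markov chain on $\{1,\dots,d\}$, with invariant probability vector $\pi$; let $\lambda,\mu\in[0,\infty)^d$, $\lambda_\infty:=\pi^{\rm T}\lambda$, $\mu_\infty:=\pi^{\rm T}\mu$, and assume $\mu_\infty>0$. Put $\Lambda:=\mathrm{diag}(\lambda)$, $\mathcal M:=\mathrm{diag}(\mu)$, let $p_{ij}(t)$ be the transition probabilities of the chain with generator $Q$, and let $D$ be the deviation matrix $D_{ij}:=\int_0^\infty(p_{ij}(t)-\pi_j)\,dt$. Model I with parameters $(\lambda,\mu,Q)$ is the infinite-server queue in which, while the background chain $J$ (with generator $Q$) is in state $i$, jobs arrive at rate $\lambda_i$ and each job present leaves at hazard rate $\mu_i$. That is, with $M(t)$ the number of jobs present at time $t$, $(J(t),M(t))_{t\ge 0}$ is the continuous-time Markov chain on $\{1,\dots,d\}\times\{0,1,2,\dots\}$ with transition rates $(i,m)\to(i,m+1)$: $\lambda_i$; $(i,m)\to(i,m-1)$: $m\mu_i$; $(i,m)\to(j,m)$, $j\ne i$: $q_{ij}$. It starts with $J(0)\sim\pi$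 and $M(0)=0$. Fix $\alpha>0$ and, for $N>0$, let $M^{(N)}(t)$ be the number of jobs in Model I with parameters $(N\lambda,\mu,N^\alpha Q)$. Define $$\varrho(t):=\frac{\lambda_\infty}{\mu_\infty}\bigl(1-e^{-\mu_\infty t}\bigr),\qquad \varsigma(t):=2\int_0^t e^{-2\mu_\infty(t-s)}\,\pi^{\rm T}\bigl(\Lambda-\varrho(s)\mathcal M\bigr)D\bigl(\Lambda-\varrho(s)\mathcal M\bigr)\mathbf 1\,ds .$$ Then all $M^{(N)}(t)$ are square integrable, the integrals defining $D$ converge absolutely, and for all $t,u\ge 0$ $$\lim_{N\to\infty}\frac{\mathrm{Cov}\bigl(M^{(N)}(t),M^{(N)}(t+u)\bigr)}{N^{\max\{1,2-\alpha\}}}=e^{-\mu_\infty u}\Bigl(\varsigma(t)\,1_{\{\alpha\le1\}}+\varrho(t)\,1_{\{\alpha\ge1\}}\Bigr).$$ -/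

import Mathlib

open MeasureTheory ProbabilityTheory Filter Topology
open scoped NNReal Matrix

noncomputable section

namespace MMInfServer

/-- `P` is a (standard, honest) transition function on the countable state space `S` whose
matrix of transition rates is `A`: every `P t` is a stochastic matrix, the Chapman-Kolmogorov
equations hold, and `P h x y = 1{x = y} + A x y * h + o(h)` as `h` decreases to `0`. -/
structure IsTransitionFunction {S : Type*} [DecidableEq S] (A : S → S → ℝ)
    (P : ℝ≥0 → S → S → ℝ) : Prop where
  nonneg : ∀ t x y, 0 ≤ P t x y
  row_sum : ∀ t x, HasSum (fun y => P t x y) 1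
  zero : ∀ x y, P 0 x y = if x = y then 1 else 0
  chapman_kolmogorov : ∀ s t x y, HasSum (fun z => P s x z * P t z y) (P (s + t) x y)
  rates : ∀ x y, Tendsto (fun h : ℝ≥0 => (P h x y - if x = y then 1 else 0) / (h : ℝ))
    (𝓝[>] 0) (𝓝 (A x y))

/-- The process `X` is, under `Pr`, a time-homogeneous continuous-time Markov chain with
transition rates `A` and initial distribution `ν` (in terms of its finite-dimensional
distributions). -/
def IsMarkovChain {S : Type*} [DecidableEq S] [MeasurableSpace S] (A : S → S → ℝ) (ν : S → ℝ)
    {Ω : Type*} [MeasurableSpace Ω] (Pr : Measure Ω) (X : ℝ≥0 → Ω → S) : Prop :=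
  (∀ t, Measurable (X t)) ∧
  ∃ P : ℝ≥0 → S → S → ℝ, IsTransitionFunction A P ∧
    ∀ (n : ℕ) (s : ℕ → ℝ≥0) (x : ℕ → S), Monotone s → s 0 = 0 →
      Pr.real {ω | ∀ k ≤ n, X (s k) ω = x k} =
        ν (x 0) * ∏ k ∈ Finset.range n, P (s (k + 1) - s k) (x k) (x (k + 1))

/-- Transition rate matrix (generator) of a Markov chain on `{1, …, d}`. -/
structure IsRateMatrix {d : ℕ} (Q : Matrix (Fin d) (Fin d) ℝ) : Prop where
  off_diag_nonneg : ∀ i j, i ≠ j → 0 ≤ Q i j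
  row_sum : ∀ i, ∑ j, Q i j = 0

/-- Every state can be reached from every other one through jumps of positive rate. -/
def IsIrreducibleRate {d : ℕ} (Q : Matrix (Fin d) (Fin d) ℝ) : Prop :=
  ∀ i j, Relation.ReflTransGen (fun a b => 0 < Q a b) i j

/-- `π` is an invariant probability vector of the chain with generator `Q`. -/
structure IsInvariantProb {d : ℕ} (Q : Matrix (Fin d) (Fin d) ℝ) (π : Fin d → ℝ) : Prop where
  nonneg : ∀ i, 0 ≤ π i
  sum_eq_one : ∑ i, π i = 1
  invariant : π ᵥ* Q = 0

/-- Transition rates of the pair (background state, number of jobs) in Model I. From `(i, m)`: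
* an arrival `(i, m) → (i, m + 1)` has rate `lam i`;
* a departure `(i, m) → (i, m - 1)` has rate `m * mu i`, each of the `m` jobs present
  having the current hazard rate `mu i`;
* a background jump `(i, m) → (j, m)`, `j ≠ i`, has rate `Q i j`.
The diagonal entry is minus the total rate, `-(lam i + m * mu i - Q i i)`. -/
def modelIRates {d : ℕ} (lam mu : Fin d → ℝ) (Q : Matrix (Fin d) (Fin d) ℝ)
    (x y : Fin d × ℕ) : ℝ :=
  (if y.1 = x.1 ∧ y.2 = x.2 + 1 then lam x.1 else 0)
    + (if y.1 = x.1 ∧ y.2 + 1 = x.2 then (x.2 : ℝ) * mu x.1 else 0)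
    + (if y.2 = x.2 then Q x.1 y.1 else 0)
    - (if y = x then lam x.1 + (x.2 : ℝ) * mu x.1 else 0)

/-- `M` is the number of jobs in the Markov-modulated infinite-server queue Model I with
arrival rates `lam`, hazard rates `mu` and background process `J` with generator `Q`,
where the system starts empty and `J 0` has distribution `π`. -/
def IsModelI {d : ℕ} (lam mu : Fin d → ℝ) (Q : Matrix (Fin d) (Fin d) ℝ) (π : Fin d → ℝ)
    {Ω : Type*} [MeasurableSpace Ω] (Pr : Measure Ω)
    (J : ℝ≥0 → Ω → Fin d) (M : ℝ≥0 → Ω → ℕ) : Prop :=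
  IsMarkovChain (modelIRates lam mu Q) (fun x => if x.2 = 0 then π x.1 else 0) Pr
    (fun t ω => (J t ω, M t ω))

/-- `p_{ij}(t) = ℙ(J(t) = j | J(0) = i)` for the chain with generator `Q`. -/
def transProb {d : ℕ} (Q : Matrix (Fin d) (Fin d) ℝ) (t : ℝ) : Matrix (Fin d) (Fin d) ℝ :=
  NormedSpace.exp (t • Q)

/-- The deviation matrix `D_{ij} = ∫_0^∞ (p_{ij}(t) - π_j) dt`. -/
def deviationMatrix {d : ℕ} (Q : Matrix (Fin d) (Fin d) ℝ) (π : Fin d → ℝ) :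
    Matrix (Fin d) (Fin d) ℝ :=
  Matrix.of fun i j => ∫ t in Set.Ioi (0 : ℝ), (transProb Q t i j - π j)

/-- `ϱ(t) = (λ_∞ / μ_∞) (1 - e^{-μ_∞ t})`, where `λ_∞ = πᵀ λ` and `μ_∞ = πᵀ μ`. -/
def rhoI {d : ℕ} (lam mu π : Fin d → ℝ) (t : ℝ) : ℝ :=
  (π ⬝ᵥ lam) / (π ⬝ᵥ mu) * (1 - Real.exp (-(π ⬝ᵥ mu) * t))

/-- `ς(t) = 2 ∫_0^t e^{-2 μ_∞ (t - s)} πᵀ (Λ - ℳ ϱ(s)) D (Λ - ℳ ϱ(s)) 1 ds`. -/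
def sigmaI {d : ℕ} (lam mu : Fin d → ℝ) (Q : Matrix (Fin d) (Fin d) ℝ) (π : Fin d → ℝ)
    (t : ℝ) : ℝ :=
  2 * ∫ s in (0 : ℝ)..t, Real.exp (-2 * (π ⬝ᵥ mu) * (t - s)) *
    (π ⬝ᵥ (((Matrix.diagonal lam - rhoI lam mu π s • Matrix.diagonal mu)
      * deviationMatrix Q π
      * (Matrix.diagonal lam - rhoI lam mu π s • Matrix.diagonal mu)) *ᵥ 1))

/-- The limiting covariance
`v(t,u) = e^{-μ_∞ u} (ς(t) 1{α ≤ 1} + ϱ(t) 1{α ≥ 1})`. -/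
def vI {d : ℕ} (lam mu : Fin d → ℝ) (Q : Matrix (Fin d) (Fin d) ℝ) (π : Fin d → ℝ)
    (α t u : ℝ) : ℝ :=
  Real.exp (-(π ⬝ᵥ mu) * u) *
    ((if α ≤ 1 then sigmaI lam mu Q π t else 0) + (if 1 ≤ α then rhoI lam mu π t else 0))

end MMInfServer

end

/-! On functions that are quadratic in the number of jobs, written in falling factorials, the
generator acts as a finite matrix (`gen_polyEval`), so first and second moments should be given by
its exponential. The state space is infinite and these functions are unbounded, so this has to be
proved. For bounded functions the backward equation follows from the rates
(`IsTransitionFunction.hasDerivAt_tsum`). Truncations are then removed by a comparison principle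
with the Lyapunov function (m+1)^3 (`nonpos_of_subsolution`,
`IsTransitionFunction.hasSum_polyEval`). The Markov property turns the covariance into an explicit
expression in the moments at time t and the coefficients of the conditional mean over the lag u
(`IsModelI.covariance_eq`).

What remains is averaging for linear differential equations. With K = N^α, divide the first moments
on {J = i} by N π_i and the second factorial moments by N² π_i. The resulting functions h and k are
driven by K times the generator of the reversed chain plus bounded terms. The spectral gap
(`exists_hasSpectralGap`) keeps their deviation from the π-average of order 1/K
(`HasSpectralGap.unifBdd_smul_fluct`). The averages then solve scalar equations up to O(1/K), so
that av h tends to ϱ. In the same way the averaged slope b of the conditional mean tends to e^{-μ_∞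
u}.

The variance needs one more order: av k - (av h)² = ς/K + O(1/K²) (`unifBdd_variance_sub_sigmaI`).
Its derivative contains the fluctuations of h and k. A corrector made from Dλ and Dμ cancels them,
because D solves the Poisson equation, and what the corrector leaves behind is exactly the source
term of ς.

In `covariance_scaled` the covariance then has two leading parts, N (av h)(av b) of order N and N²
(av k - (av h)²)(av b) of order N²/K = N^{2-α}. Dividing by N^{max(1, 2-α)} keeps the larger one, or
both when α = 1. -/

noncomputable section

namespace MMInfServer

/-! ### The generator and a comparison principle -/

/-- The generator of Model I acting on functions of the state. -/
def gen {d : ℕ} (lam mu : Fin d → ℝ) (Q : Matrix (Fin d) (Fin d) ℝ) (f : Fin d × ℕ → ℝ)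
    (x : Fin d × ℕ) : ℝ :=
  lam x.1 * (f (x.1, x.2 + 1) - f x) + x.2 * mu x.1 * (f (x.1, x.2 - 1) - f x)
    + ∑ j, Q x.1 j * f (j, x.2)

/-- A finite set of states containing all states that can be reached in one jump. -/
def nbhdStates {d : ℕ} (x : Fin d × ℕ) : Finset (Fin d × ℕ) :=
  Finset.univ ×ˢ Finset.range (x.2 + 2)

lemma self_mem_nbhdStates {d : ℕ} (x : Fin d × ℕ) : x ∈ nbhdStates x := by
  simp [nbhdStates]

lemma sum_modelIRates_mul {d : ℕ} (lam mu : Fin d → ℝ) (Q : Matrix (Fin d) (Fin d) ℝ)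
    (f : Fin d × ℕ → ℝ) (x : Fin d × ℕ) :
    ∑ y ∈ nbhdStates x, modelIRates lam mu Q x y * f y = gen lam mu Q f x := by
  obtain ⟨i, m⟩ := x
  have h1 : ∑ y ∈ nbhdStates (i, m), (if y.1 = i ∧ y.2 = m + 1 then lam i else 0) * f y
      = lam i * f (i, m + 1) := by
    rw [Finset.sum_eq_single (i, m + 1)]
    · simp
    · rintro ⟨j, n⟩ - hne
      have : ¬ (j = i ∧ n = m + 1) := by simpa using hne
      simp only [this, if_false, zero_mul]
    · intro h; simp [nbhdStates] at h
  have h2 : ∑ y ∈ nbhdStates (i, m), (if y.1 = i ∧ y.2 + 1 = m then (m : ℝ) * mu i else 0) * f y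
      = m * mu i * f (i, m - 1) := by
    -- At m = 0 the truncated m - 1 is again 0, which is harmless because the rate carries the
    -- factor m.
    rcases m with _ | m
    · simp
    rw [Finset.sum_eq_single (i, m)]
    · simp
    · rintro ⟨j, n⟩ - hne
      have : ¬ (j = i ∧ n + 1 = m + 1) := by simpa using hne
      simp only [this, if_false, zero_mul]
    · intro h; simp [nbhdStates] at h; omega
  have h3 : ∑ y ∈ nbhdStates (i, m), (if y.2 = m then Q i y.1 else 0) * f y
      = ∑ j, Q i j * f (j, m) := by
    rw [nbhdStates, Finset.sum_product]
    refine Finset.sum_congr rfl fun j _ => ?_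
    rw [Finset.sum_eq_single m]
    · simp
    · intro n _ hne; simp [hne]
    · intro h; simp at h
  have h4 : ∑ y ∈ nbhdStates (i, m), (if y = (i, m) then lam i + (m : ℝ) * mu i else 0) * f y
      = (lam i + m * mu i) * f (i, m) := by
    rw [Finset.sum_eq_single (i, m)]
    · simp
    · intro y _ hne; simp [hne]
    · intro h; exact absurd (self_mem_nbhdStates _) h
  simp only [modelIRates, sub_mul, add_mul, Finset.sum_add_distrib, Finset.sum_sub_distrib,
    h1, h2, h3]
  simp only [add_mul] at h4
  simp only [h4, gen]
  ring

lemma gen_smul {d : ℕ} (lam mu : Fin d → ℝ) (Q : Matrix (Fin d) (Fin d) ℝ)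
    (a : ℝ) (f : Fin d × ℕ → ℝ) (x : Fin d × ℕ) :
    gen lam mu Q (fun y => a * f y) x = a * gen lam mu Q f x := by
  simp only [← sum_modelIRates_mul, Finset.mul_sum]
  exact Finset.sum_congr rfl fun y _ => by ring

lemma gen_sub {d : ℕ} (lam mu : Fin d → ℝ) (Q : Matrix (Fin d) (Fin d) ℝ)
    (f g : Fin d × ℕ → ℝ) (x : Fin d × ℕ) :
    gen lam mu Q (fun y => f y - g y) x = gen lam mu Q f x - gen lam mu Q g x := by
  simp only [← sum_modelIRates_mul, mul_sub, Finset.sum_sub_distrib]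

lemma modelIRates_nonneg {d : ℕ} {lam mu : Fin d → ℝ} {Q : Matrix (Fin d) (Fin d) ℝ}
    (hQ : IsRateMatrix Q) (hlam : ∀ i, 0 ≤ lam i) (hmu : ∀ i, 0 ≤ mu i)
    {x y : Fin d × ℕ} (hxy : y ≠ x) : 0 ≤ modelIRates lam mu Q x y := by
  have h1 : 0 ≤ (if y.1 = x.1 ∧ y.2 = x.2 + 1 then lam x.1 else 0) := by
    split_ifs; exacts [hlam _, le_rfl]
  have h2 : 0 ≤ (if y.1 = x.1 ∧ y.2 + 1 = x.2 then (x.2 : ℝ) * mu x.1 else 0) := by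
    split_ifs; exacts [mul_nonneg (Nat.cast_nonneg _) (hmu _), le_rfl]
  have h3 : 0 ≤ (if y.2 = x.2 then Q x.1 y.1 else 0) := by
    split_ifs with h
    · refine hQ.off_diag_nonneg _ _ fun h' => hxy (Prod.ext h'.symm h)
    · exact le_rfl
  simp only [modelIRates, hxy, if_false, sub_zero]
  positivity

lemma gen_const {d : ℕ} {lam mu : Fin d → ℝ} {Q : Matrix (Fin d) (Fin d) ℝ}
    (hQ : IsRateMatrix Q) (x : Fin d × ℕ) : gen lam mu Q (fun _ => 1) x = 0 := by
  simp [gen, hQ.row_sum]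

/-- The maximum principle at a point: if `f ≤ g` with equality at `x`, then
`gen f x ≤ gen g x`. -/
lemma gen_le_gen_of_le {d : ℕ} {lam mu : Fin d → ℝ} {Q : Matrix (Fin d) (Fin d) ℝ}
    (hQ : IsRateMatrix Q) (hlam : ∀ i, 0 ≤ lam i) (hmu : ∀ i, 0 ≤ mu i)
    {f g : Fin d × ℕ → ℝ} {x : Fin d × ℕ} (hfg : ∀ y, f y ≤ g y) (hx : f x = g x) :
    gen lam mu Q f x ≤ gen lam mu Q g x := by
  simp only [← sum_modelIRates_mul]
  refine Finset.sum_le_sum fun y _ => ?_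
  rcases eq_or_ne y x with rfl | hne
  · rw [hx]
  · exact mul_le_mul_of_nonneg_left (hfg y) (modelIRates_nonneg hQ hlam hmu hne)

/-- Lyapunov bound: arrivals multiply (m+1)^3 by at most 8, departures decrease it, and background
jumps do not see it. The degree is 3 so that the function dominates the quadratic growth of the
second moments. -/
lemma gen_cube_le {d : ℕ} {lam mu : Fin d → ℝ} {Q : Matrix (Fin d) (Fin d) ℝ}
    (hQ : IsRateMatrix Q) (hmu : ∀ i, 0 ≤ mu i) (hlam : ∀ i, 0 ≤ lam i)
    {C : ℝ} (hC : ∀ i, 7 * lam i ≤ C) (x : Fin d × ℕ) :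
    gen lam mu Q (fun y => ((y.2 : ℝ) + 1) ^ 3) x ≤ C * ((x.2 : ℝ) + 1) ^ 3 := by
  obtain ⟨i, m⟩ := x
  have h1 : lam i * ((((m + 1 : ℕ) : ℝ) + 1) ^ 3 - ((m : ℝ) + 1) ^ 3) ≤ C * ((m : ℝ) + 1) ^ 3 := by
    have hm : (0 : ℝ) ≤ m := Nat.cast_nonneg _
    have : (((m + 1 : ℕ) : ℝ) + 1) ^ 3 - ((m : ℝ) + 1) ^ 3 ≤ 7 * ((m : ℝ) + 1) ^ 3 := by
      have : ((m + 1 : ℕ) : ℝ) + 1 ≤ 2 * ((m : ℝ) + 1) := by push_cast; linarith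
      have := pow_le_pow_left₀ (by positivity) this 3
      rw [mul_pow] at this
      linarith
    calc _ ≤ lam i * (7 * ((m : ℝ) + 1) ^ 3) := mul_le_mul_of_nonneg_left this (hlam i)
      _ = (7 * lam i) * ((m : ℝ) + 1) ^ 3 := by ring
      _ ≤ _ := mul_le_mul_of_nonneg_right (hC i) (by positivity)
  have h2 : (m : ℝ) * mu i * ((((m - 1 : ℕ) : ℝ) + 1) ^ 3 - ((m : ℝ) + 1) ^ 3) ≤ 0 := by
    refine mul_nonpos_of_nonneg_of_nonpos (mul_nonneg (Nat.cast_nonneg _) (hmu i)) ?_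
    have : ((m - 1 : ℕ) : ℝ) ≤ m := by exact_mod_cast Nat.sub_le _ _
    have := pow_le_pow_left₀ (by positivity) (add_le_add_left this 1) 3
    linarith
  have h3 : ∑ j, Q i j * ((m : ℝ) + 1) ^ 3 = 0 := by
    rw [← Finset.sum_mul, hQ.row_sum, zero_mul]
  simp only [gen]
  rw [h3]
  linarith

/-- Only slopes from the left are used, since the maximum may sit at the right end of the time
interval. -/
lemma deriv_nonneg_of_isMaxOn_Icc {f : ℝ → ℝ} {f' a t : ℝ} (hat : a < t)
    (hf : HasDerivAt f f' t) (hmax : ∀ s ∈ Set.Icc a t, f s ≤ f t) : 0 ≤ f' := by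
  have h := hf.hasDerivWithinAt (s := Set.Iio t)
  rw [hasDerivWithinAt_iff_tendsto_slope' (by simp)] at h
  refine ge_of_tendsto h ?_
  filter_upwards [Ioo_mem_nhdsLT hat] with s hs
  rw [slope_def_field]
  exact div_nonneg_of_nonpos (by linarith [hmax s ⟨hs.1.le, hs.2.le⟩]) (by linarith [hs.2])

/-- Comparison principle for subsolutions of the backward equation of at most quadratic
growth. -/
theorem nonpos_of_subsolution {d : ℕ} {lam mu : Fin d → ℝ} {Q : Matrix (Fin d) (Fin d) ℝ}
    (hQ : IsRateMatrix Q) (hlam : ∀ i, 0 ≤ lam i) (hmu : ∀ i, 0 ≤ mu i)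
    {T R : ℝ} {f f' : ℝ → Fin d × ℕ → ℝ}
    (hcont : ∀ x, ContinuousOn (fun t => f t x) (Set.Icc 0 T))
    (hderiv : ∀ t ∈ Set.Ioc 0 T, ∀ x, HasDerivAt (fun s => f s x) (f' t x) t)
    (hsub : ∀ t ∈ Set.Ioc 0 T, ∀ x, f' t x ≤ gen lam mu Q (f t) x)
    (hzero : ∀ x, f 0 x ≤ 0)
    (hgrowth : ∀ t ∈ Set.Icc 0 T, ∀ x, f t x ≤ R * ((x.2 : ℝ) + 1) ^ 2) :
    ∀ t ∈ Set.Icc 0 T, ∀ x, f t x ≤ 0 := by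
  by_contra! hcon
  obtain ⟨t₁, ht₁, x₁, hx₁⟩ := hcon
  obtain ⟨C, hC⟩ : ∃ C : ℝ, ∀ i, 7 * lam i ≤ C :=
    ⟨∑ i, 7 * lam i, fun i => Finset.single_le_sum (f := fun i => 7 * lam i)
      (fun j _ => mul_nonneg (by norm_num) (hlam j)) (Finset.mem_univ i)⟩
  -- The cubic weight makes `g` vanish at infinity, uniformly in time, so a positive supremum is
  -- attained. The rate C + 1 in the exponential strictly beats the constant C of `gen_cube_le`.
  set g : ℝ → Fin d × ℕ → ℝ :=
    fun t x => Real.exp (-(C + 1) * t) * f t x / ((x.2 : ℝ) + 1) ^ 3 with hg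
  have hC0 : 0 ≤ C := le_trans (mul_nonneg (by norm_num) (hlam x₁.1)) (hC x₁.1)
  have hR0 : 0 < R := by
    have := lt_of_lt_of_le hx₁ (hgrowth t₁ ht₁ x₁)
    exact pos_of_mul_pos_left this (by positivity)
  have hgle : ∀ t ∈ Set.Icc 0 T, ∀ x, g t x ≤ R / ((x.2 : ℝ) + 1) := by
    intro t ht x
    have hp : (0 : ℝ) < (x.2 : ℝ) + 1 := by positivity
    rw [hg, div_le_div_iff₀ (by positivity) hp]
    have he : Real.exp (-(C + 1) * t) ≤ 1 := by
      rw [Real.exp_le_one_iff]; nlinarith [ht.1]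
    have h1 : Real.exp (-(C + 1) * t) * f t x ≤ R * ((x.2 : ℝ) + 1) ^ 2 :=
      calc _ ≤ Real.exp (-(C + 1) * t) * (R * ((x.2 : ℝ) + 1) ^ 2) :=
            mul_le_mul_of_nonneg_left (hgrowth t ht x) (Real.exp_pos _).le
        _ ≤ 1 * (R * ((x.2 : ℝ) + 1) ^ 2) := mul_le_mul_of_nonneg_right he (by positivity)
        _ = _ := one_mul _
    calc _ ≤ R * ((x.2 : ℝ) + 1) ^ 2 * ((x.2 : ℝ) + 1) := mul_le_mul_of_nonneg_right h1 hp.le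
      _ = _ := by ring
  have hg1 : 0 < g t₁ x₁ := by
    have : 0 < Real.exp (-(C + 1) * t₁) := Real.exp_pos _
    simp only [hg]; positivity
  -- Beyond `m₀` jobs `g` stays below its value at the assumed positive point, so only finitely many
  -- states compete for the maximum.
  obtain ⟨m₀, hm₀⟩ := exists_nat_gt (R / g t₁ x₁)
  set F : Finset (Fin d × ℕ) := Finset.univ ×ˢ Finset.range (m₀ + 1 + x₁.2) with hF
  have hout : ∀ t ∈ Set.Icc 0 T, ∀ x, x ∉ F → g t x ≤ g t₁ x₁ := by
    intro t ht x hx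
    refine (hgle t ht x).trans ?_
    have hx2 : m₀ + 1 + x₁.2 ≤ x.2 := by simpa [hF] using hx
    have : (m₀ : ℝ) ≤ x.2 := by exact_mod_cast (by omega : m₀ ≤ x.2)
    rw [div_lt_iff₀ hg1] at hm₀
    rw [div_le_iff₀ (by positivity)]
    nlinarith
  have hx₁F : x₁ ∈ F := by simp [hF]
  have hgc : ∀ x, ContinuousOn (fun t => g t x) (Set.Icc 0 T) := fun x => by
    simp only [hg]
    exact ((by fun_prop : Continuous fun t : ℝ => Real.exp (-(C + 1) * t)).continuousOn.mul
      (hcont x)).div_const _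
  have hmaxx : ∀ x, ∃ t ∈ Set.Icc 0 T, ∀ s ∈ Set.Icc 0 T, g s x ≤ g t x := fun x =>
    isCompact_Icc.exists_isMaxOn ⟨t₁, ht₁⟩ (hgc x)
  choose τ hτ hτmax using hmaxx
  obtain ⟨x₀, hx₀F, hx₀⟩ := F.exists_max_image (fun x => g (τ x) x) ⟨x₁, hx₁F⟩
  set t₀ := τ x₀ with ht₀
  have hge : g t₁ x₁ ≤ g t₀ x₀ := (hτmax x₁ t₁ ht₁).trans (hx₀ x₁ hx₁F)
  have hmax : ∀ t ∈ Set.Icc 0 T, ∀ x, g t x ≤ g t₀ x₀ := by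
    intro t ht x
    by_cases hx : x ∈ F
    · exact (hτmax x t ht).trans (hx₀ x hx)
    · exact (hout t ht x hx).trans hge
  have hs0 : 0 < g t₀ x₀ := hg1.trans_le hge
  have ht₀mem : t₀ ∈ Set.Icc 0 T := hτ x₀
  have ht₀pos : 0 < t₀ := by
    rcases ht₀mem.1.eq_or_lt with h | h
    · exfalso
      rw [← h] at hs0
      have : g 0 x₀ ≤ 0 := by
        simp only [hg]
        exact div_nonpos_of_nonpos_of_nonneg
          (mul_nonpos_of_nonneg_of_nonpos (Real.exp_pos _).le (hzero x₀)) (by positivity)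
      linarith
    · exact h
  have ht₀' : t₀ ∈ Set.Ioc 0 T := ⟨ht₀pos, ht₀mem.2⟩
  set V : Fin d × ℕ → ℝ := fun y => ((y.2 : ℝ) + 1) ^ 3 with hV
  have hVpos : ∀ x, 0 < V x := fun x => by simp only [hV]; positivity
  have hfg : ∀ x, f t₀ x = Real.exp ((C + 1) * t₀) * g t₀ x * V x := by
    intro x
    have h1 : Real.exp ((C + 1) * t₀) * Real.exp (-(C + 1) * t₀) = 1 := by
      rw [← Real.exp_add, neg_mul, add_neg_cancel, Real.exp_zero]
    have h2 := (hVpos x).ne'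
    have h3 : g t₀ x * V x = Real.exp (-(C + 1) * t₀) * f t₀ x := div_mul_cancel₀ _ h2
    rw [mul_assoc, h3, ← mul_assoc, h1, one_mul]
  have hd : HasDerivAt (fun s => g s x₀)
      ((-(C + 1) * Real.exp (-(C + 1) * t₀) * f t₀ x₀ + Real.exp (-(C + 1) * t₀) * f' t₀ x₀)
        / V x₀) t₀ := by
    have h1 : HasDerivAt (fun s : ℝ => Real.exp (-(C + 1) * s))
        (-(C + 1) * Real.exp (-(C + 1) * t₀)) t₀ := by
      have := ((hasDerivAt_id t₀).const_mul (-(C + 1))).exp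
      simpa [mul_comm] using this
    exact (h1.mul (hderiv t₀ ht₀' x₀)).div_const _
  have hd0 := deriv_nonneg_of_isMaxOn_Icc ht₀pos hd
    (fun s hs => hmax s ⟨hs.1, hs.2.trans ht₀mem.2⟩ x₀)
  have hd1 : (C + 1) * f t₀ x₀ ≤ f' t₀ x₀ := by
    have h0 := mul_nonneg hd0 (hVpos x₀).le
    rw [div_mul_cancel₀ _ (hVpos x₀).ne'] at h0
    have h1 : 0 ≤ Real.exp (-(C + 1) * t₀) * (f' t₀ x₀ - (C + 1) * f t₀ x₀) := by linarith
    have := nonneg_of_mul_nonneg_right h1 (Real.exp_pos _)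
    linarith
  set s := Real.exp ((C + 1) * t₀) * g t₀ x₀ with hs
  have hspos : 0 < s := mul_pos (Real.exp_pos _) hs0
  -- The multiple `s * V` touches `f t₀` from above at `x₀`. Hence f' ≤ gen f ≤ C f there, against
  -- f' ≥ (C + 1) f from maximality in time, although f > 0.
  have hgen : gen lam mu Q (f t₀) x₀ ≤ gen lam mu Q (fun y => s * V y) x₀ := by
    refine gen_le_gen_of_le hQ hlam hmu (fun y => ?_) (hfg x₀)
    rw [hfg y]
    exact mul_le_mul_of_nonneg_right
      (mul_le_mul_of_nonneg_left (hmax t₀ ht₀mem y) (Real.exp_pos _).le) (hVpos y).le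
  rw [gen_smul] at hgen
  have h5 := mul_le_mul_of_nonneg_left (gen_cube_le hQ hmu hlam hC x₀) hspos.le
  have h6 := hsub t₀ ht₀' x₀
  have h7 : f t₀ x₀ = s * V x₀ := hfg x₀
  have h8 : 0 < s * V x₀ := mul_pos hspos (hVpos x₀)
  rw [h7] at hd1
  have h9 : s * (C * ((x₀.2 : ℝ) + 1) ^ 3) = C * (s * V x₀) := by simp only [hV]; ring
  simp only [← hV] at h5
  linarith

/-! ### The transition semigroup on bounded functions -/

section Semigroup

variable {S : Type*} [DecidableEq S] {A : S → S → ℝ} {P : ℝ≥0 → S → S → ℝ}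

lemma IsTransitionFunction.summable_mul (hP : IsTransitionFunction A P) {g : S → ℝ} {B : ℝ}
    (hg : ∀ y, |g y| ≤ B) (t : ℝ≥0) (x : S) : Summable fun y => P t x y * g y := by
  refine Summable.of_norm_bounded ((hP.row_sum t x).summable.mul_right B) fun y => ?_
  rw [Real.norm_eq_abs, abs_mul, abs_of_nonneg (hP.nonneg t x y)]
  exact mul_le_mul_of_nonneg_left (hg y) (hP.nonneg t x y)

/-- The mass escaping a finite set controls the error of truncating to this set. -/
lemma IsTransitionFunction.abs_tsum_sub_sum_le (hP : IsTransitionFunction A P) {g : S → ℝ} {B : ℝ}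
    (hg : ∀ y, |g y| ≤ B) (t : ℝ≥0) (x : S) (F : Finset S) :
    |∑' y, P t x y * g y - ∑ y ∈ F, P t x y * g y| ≤ B * (1 - ∑ y ∈ F, P t x y) := by
  have hs := (hP.summable_mul hg t x).hasSum
  have hB := (hP.row_sum t x).mul_left B
  have h1 := sum_le_hasSum F (fun y _ => ?_) (hB.sub hs)
  have h2 := sum_le_hasSum F (fun y _ => ?_) (hB.add hs)
  · rw [Finset.sum_sub_distrib, ← Finset.mul_sum] at h1
    rw [Finset.sum_add_distrib, ← Finset.mul_sum] at h2
    rw [abs_le]; constructor <;> linarith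
  · have := mul_le_mul_of_nonneg_left (neg_le_of_abs_le (hg y)) (hP.nonneg t x y)
    linarith
  · have := mul_le_mul_of_nonneg_left (le_of_abs_le (hg y)) (hP.nonneg t x y)
    linarith

lemma IsTransitionFunction.abs_tsum_le (hP : IsTransitionFunction A P) {g : S → ℝ} {B : ℝ}
    (hg : ∀ y, |g y| ≤ B) (t : ℝ≥0) (x : S) : |∑' y, P t x y * g y| ≤ B := by
  simpa using hP.abs_tsum_sub_sum_le hg t x ∅

lemma IsTransitionFunction.le_one (hP : IsTransitionFunction A P) (t : ℝ≥0) (x y : S) :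
    P t x y ≤ 1 :=
  le_hasSum (hP.row_sum t x) y fun z _ => hP.nonneg t x z

/-- Chapman-Kolmogorov integrated against `g`; the exchange of sums is dominated by B times the
joint law of the two steps. -/
lemma IsTransitionFunction.tsum_add (hP : IsTransitionFunction A P) {g : S → ℝ} {B : ℝ}
    (hg : ∀ y, |g y| ≤ B) (s t : ℝ≥0) (x : S) :
    ∑' y, P (s + t) x y * g y = ∑' z, P s x z * ∑' y, P t z y * g y := by
  have hnn : Summable fun p : S × S => P s x p.1 * P t p.1 p.2 := by
    rw [summable_prod_of_nonneg (fun p => mul_nonneg (hP.nonneg _ _ _) (hP.nonneg _ _ _))]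
    constructor
    · intro z
      show Summable fun y => P s x z * P t z y
      exact (hP.row_sum t z).summable.mul_left (P s x z)
    · show Summable fun z => ∑' y, P s x z * P t z y
      simp only [tsum_mul_left, (hP.row_sum t _).tsum_eq, mul_one]
      exact (hP.row_sum s x).summable
  have hsum : Summable fun p : S × S => P s x p.1 * P t p.1 p.2 * g p.2 := by
    refine Summable.of_norm_bounded (hnn.mul_right B) fun p => ?_
    have h0 := mul_nonneg (hP.nonneg s x p.1) (hP.nonneg t p.1 p.2)
    rw [Real.norm_eq_abs, abs_mul, abs_of_nonneg h0]
    exact mul_le_mul_of_nonneg_left (hg _) h0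
  calc ∑' y, P (s + t) x y * g y = ∑' y, ∑' z, P s x z * P t z y * g y := by
        refine tsum_congr fun y => ?_
        rw [← (hP.chapman_kolmogorov s t x y).tsum_eq, tsum_mul_right]
    _ = ∑' z, ∑' y, P s x z * P t z y * g y := hsum.tsum_comm
    _ = _ := by simp only [mul_assoc, tsum_mul_left]

lemma IsTransitionFunction.tsum_zero (hP : IsTransitionFunction A P) (g : S → ℝ) (x : S) :
    ∑' y, P 0 x y * g y = g x := by
  rw [tsum_eq_single x]
  · simp [hP.zero]
  · intro y hy; simp [hP.zero, hy.symm]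

lemma IsTransitionFunction.tendsto_self (hP : IsTransitionFunction A P) (x : S) :
    Tendsto (fun h => P h x x) (𝓝 0) (𝓝 1) := by
  have h0 : Tendsto (fun h => P h x x) (𝓝[>] 0) (𝓝 1) := by
    have h1 := hP.rates x x
    have h2 : Tendsto (fun h : ℝ≥0 => (h : ℝ)) (𝓝[>] 0) (𝓝 0) :=
      (NNReal.continuous_coe.tendsto' 0 0 rfl).mono_left nhdsWithin_le_nhds
    have h3 := (h1.mul h2).add_const 1
    simp only [mul_zero, zero_add, if_true] at h3
    refine h3.congr' ?_
    filter_upwards [self_mem_nhdsWithin] with h hh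
    have : (h : ℝ) ≠ 0 := by exact_mod_cast (ne_of_gt hh)
    rw [div_mul_cancel₀ _ this]; ring
  have h4 : ContinuousWithinAt (fun h => P h x x) (Set.Ioi 0) 0 := by
    simpa [ContinuousWithinAt, hP.zero] using h0
  rw [continuousWithinAt_Ioi_iff_Ici] at h4
  -- In `ℝ≥0` the right neighbourhoods of 0 are all its neighbourhoods.
  have h5 : Set.Ici (0 : ℝ≥0) = Set.univ := Set.eq_univ_of_forall fun h => Set.mem_Ici.2 zero_le
  rw [h5, continuousWithinAt_univ] at h4
  simpa [hP.zero] using h4.tendsto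

/-- Spend the short time h first: the chain is still at x with probability P_h(x,x), and the
remaining mass changes the value by at most 2B. The bound does not depend on t. -/
lemma IsTransitionFunction.abs_tsum_add_sub_le (hP : IsTransitionFunction A P) {g : S → ℝ} {B : ℝ}
    (hg : ∀ y, |g y| ≤ B) (t h : ℝ≥0) (x : S) :
    |∑' y, P (t + h) x y * g y - ∑' y, P t x y * g y| ≤ 2 * B * (1 - P h x x) := by
  rw [add_comm t h, hP.tsum_add hg]
  have h1 := hP.abs_tsum_sub_sum_le (fun z => hP.abs_tsum_le hg t z) h x {x}
  simp only [Finset.sum_singleton] at h1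
  have h2 : |P h x x * (∑' y, P t x y * g y) - ∑' y, P t x y * g y| ≤ B * (1 - P h x x) := by
    have h3 := hP.abs_tsum_le hg t x
    have h4 : 0 ≤ 1 - P h x x := by linarith [hP.le_one h x x]
    rw [← sub_one_mul, abs_mul, abs_sub_comm, abs_of_nonneg h4, mul_comm]
    exact mul_le_mul_of_nonneg_right h3 h4
  have := abs_add_le (∑' z, P h x z * (∑' y, P t z y * g y) - P h x x * ∑' y, P t x y * g y)
    (P h x x * (∑' y, P t x y * g y) - ∑' y, P t x y * g y)
  rw [sub_add_sub_cancel] at this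
  linarith

lemma IsTransitionFunction.continuous_tsum (hP : IsTransitionFunction A P) {g : S → ℝ} {B : ℝ}
    (hg : ∀ y, |g y| ≤ B) (x : S) : Continuous fun t => ∑' y, P t x y * g y := by
  rw [continuous_iff_continuousAt]
  intro t
  -- With truncated subtraction, `s - t + (t - s)` is the distance between s and t.
  have key : ∀ s, |∑' y, P s x y * g y - ∑' y, P t x y * g y|
      ≤ 2 * B * (1 - P (s - t + (t - s)) x x) := by
    intro s
    rcases le_total t s with hst | hst
    · have := hP.abs_tsum_add_sub_le hg t (s - t) x
      rw [add_tsub_cancel_of_le hst] at this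
      rwa [tsub_eq_zero_of_le hst, add_zero]
    · have := hP.abs_tsum_add_sub_le hg s (t - s) x
      rw [add_tsub_cancel_of_le hst, abs_sub_comm] at this
      rwa [tsub_eq_zero_of_le hst, zero_add]
  rw [ContinuousAt, tendsto_iff_norm_sub_tendsto_zero]
  refine squeeze_zero (fun _ => norm_nonneg _) key ?_
  have h1 : Tendsto (fun s : ℝ≥0 => s - t + (t - s)) (𝓝 t) (𝓝 0) := by
    have : Continuous fun s : ℝ≥0 => s - t + (t - s) := by fun_prop
    exact this.tendsto' _ _ (by simp)
  have h2 := (((hP.tendsto_self x).comp h1).const_sub 1).const_mul (2 * B)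
  simpa using h2

end Semigroup

/-! ### The backward equation -/

section Backward

variable {d : ℕ} {lam mu : Fin d → ℝ} {Q : Matrix (Fin d) (Fin d) ℝ}
  {P : ℝ≥0 → Fin d × ℕ → Fin d × ℕ → ℝ}

/-- The rates control only finitely many entries at a time. The mass outside `nbhdStates x` is
nevertheless o(h), because the rates inside already sum to zero, so a bounded function does not
notice it. -/
lemma IsTransitionFunction.tendsto_gen (hQ : IsRateMatrix Q)
    (hP : IsTransitionFunction (modelIRates lam mu Q) P) {g : Fin d × ℕ → ℝ} {B : ℝ}
    (hg : ∀ y, |g y| ≤ B) (x : Fin d × ℕ) :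
    Tendsto (fun h : ℝ≥0 => (∑' y, P h x y * g y - g x) / (h : ℝ)) (𝓝[>] 0)
      (𝓝 (gen lam mu Q g x)) := by
  have hlim : ∀ f : Fin d × ℕ → ℝ, Tendsto (fun h : ℝ≥0 =>
      (∑ y ∈ nbhdStates x, P h x y * f y - f x) / (h : ℝ)) (𝓝[>] 0)
      (𝓝 (gen lam mu Q f x)) := by
    intro f
    rw [← sum_modelIRates_mul]
    refine (tendsto_finsetSum (nbhdStates x)
      fun y _ => (hP.rates x y).mul_const (f y)).congr fun h => ?_
    have : f x = ∑ y ∈ nbhdStates x, (if x = y then 1 else 0) * f y := by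
      simp [self_mem_nbhdStates]
    rw [this, ← Finset.sum_sub_distrib, Finset.sum_div]
    exact Finset.sum_congr rfl fun y _ => by ring
  have h1 := hlim g
  have h2 := (hlim fun _ => 1).const_mul (-B)
  rw [gen_const hQ, mul_zero] at h2
  have h3 : Tendsto (fun h : ℝ≥0 =>
      (∑' y, P h x y * g y - ∑ y ∈ nbhdStates x, P h x y * g y) / (h : ℝ)) (𝓝[>] 0) (𝓝 0) := by
    refine squeeze_zero_norm (fun h => ?_) h2
    rw [Real.norm_eq_abs, abs_div, abs_of_nonneg h.coe_nonneg, mul_div_assoc']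
    refine div_le_div_of_nonneg_right ?_ h.coe_nonneg
    refine (hP.abs_tsum_sub_sum_le hg h x _).trans (le_of_eq ?_)
    simp only [mul_one]; ring
  have h4 := h1.add h3
  rw [add_zero] at h4
  refine h4.congr fun h => ?_
  rw [← add_div]; ring

/-- The backward equation for bounded functions. -/
theorem IsTransitionFunction.hasDerivAt_tsum (hQ : IsRateMatrix Q)
    (hP : IsTransitionFunction (modelIRates lam mu Q) P) {g : Fin d × ℕ → ℝ} {B : ℝ}
    (hg : ∀ y, |g y| ≤ B) {t : ℝ} (ht : 0 < t) (x : Fin d × ℕ) :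
    HasDerivAt (fun s : ℝ => ∑' y, P s.toNNReal x y * g y)
      (gen lam mu Q (fun z => ∑' y, P t.toNNReal z y * g y) x) t := by
  set U : ℝ → Fin d × ℕ → ℝ := fun s z => ∑' y, P s.toNNReal z y * g y with hU
  have hUc : ∀ z, Continuous fun s => U s z := fun z =>
    (hP.continuous_tsum hg z).comp continuous_real_toNNReal
  have hGc : Continuous fun s => gen lam mu Q (U s) x := by
    simp only [gen]
    have := hUc
    fun_prop
  -- The semigroup property yields only a right derivative. As it is continuous in time, `U` is its
  -- integral, and this makes the derivative two-sided.
  have hright : ∀ s : ℝ, 0 ≤ s →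
      HasDerivWithinAt (fun r => U r x) (gen lam mu Q (U s) x) (Set.Ioi s) s := by
    intro s hs
    rw [hasDerivWithinAt_iff_tendsto_slope' (by simp)]
    have h1 := hP.tendsto_gen hQ (fun z => hP.abs_tsum_le hg s.toNNReal z) x
    have h2 : Tendsto (fun r : ℝ => (r - s).toNNReal) (𝓝[>] s) (𝓝[>] 0) := by
      refine tendsto_nhdsWithin_iff.2 ⟨?_, ?_⟩
      · have : Continuous fun r : ℝ => (r - s).toNNReal := by fun_prop
        exact (this.tendsto' s 0 (by simp)).mono_left nhdsWithin_le_nhds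
      · filter_upwards [self_mem_nhdsWithin] with r hr
        simpa using hr
    refine (h1.comp h2).congr' ?_
    filter_upwards [self_mem_nhdsWithin] with r hr
    have hr' : s < r := hr
    simp only [Function.comp, slope_def_field, hU]
    rw [← hP.tsum_add hg, Real.coe_toNNReal _ (by linarith),
      ← Real.toNNReal_add (by linarith) hs, sub_add_cancel]
  have hint : ∀ s : ℝ, 0 ≤ s → U s x = U 0 x + ∫ r in (0 : ℝ)..s, gen lam mu Q (U r) x := by
    intro s hs
    rw [intervalIntegral.integral_eq_sub_of_hasDeriv_right_of_le hs (hUc x).continuousOn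
      (fun r hr => hright r hr.1.le) (hGc.intervalIntegrable _ _)]
    ring
  have hd : HasDerivAt (fun s => U 0 x + ∫ r in (0 : ℝ)..s, gen lam mu Q (U r) x)
      (gen lam mu Q (U t) x) t :=
    (hGc.integral_hasStrictDerivAt 0 t).hasDerivAt.const_add _
  refine hd.congr_of_eventuallyEq ?_
  filter_upwards [lt_mem_nhds ht] with s hs using hint s hs.le

end Backward

/-! ### Matrix exponentials and the moment matrix -/

lemma hasDerivAt_exp_smul_apply {ι : Type*} [Fintype ι] [DecidableEq ι] (L : Matrix ι ι ℝ)
    (t : ℝ) (i j : ι) :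
    HasDerivAt (fun s : ℝ => NormedSpace.exp (s • L) i j) ((NormedSpace.exp (t • L) * L) i j) t := by
  let _ : NormedRing (Matrix ι ι ℝ) := Matrix.linftyOpNormedRing
  let _ : NormedAlgebra ℝ (Matrix ι ι ℝ) := Matrix.linftyOpNormedAlgebra
  have h : HasDerivAt (fun s : ℝ => NormedSpace.exp (s • L)) (NormedSpace.exp (t • L) * L) t :=
    hasDerivAt_exp_smul_const L t
  have h2 := (LinearMap.toContinuousLinearMap (Matrix.entryLinearMap ℝ ℝ i j :
    Matrix ι ι ℝ →ₗ[ℝ] ℝ)).hasFDerivAt.comp_hasDerivAt t h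
  exact h2

lemma exp_smul_mul_comm {ι : Type*} [Fintype ι] [DecidableEq ι] (L : Matrix ι ι ℝ) (t : ℝ) :
    NormedSpace.exp (t • L) * L = L * NormedSpace.exp (t • L) :=
  ((((Commute.refl L).smul_left t).exp_left).eq)

lemma hasDerivAt_exp_smul_mulVec {ι : Type*} [Fintype ι] [DecidableEq ι] (L : Matrix ι ι ℝ)
    (c : ι → ℝ) (t : ℝ) (i : ι) :
    HasDerivAt (fun s : ℝ => (NormedSpace.exp (s • L) *ᵥ c) i)
      ((L *ᵥ (NormedSpace.exp (t • L) *ᵥ c)) i) t := by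
  rw [Matrix.mulVec_mulVec, ← exp_smul_mul_comm]
  exact HasDerivAt.fun_sum fun j _ => (hasDerivAt_exp_smul_apply L t i j).mul_const (c j)

lemma hasDerivAt_vecMul_exp_smul {ι : Type*} [Fintype ι] [DecidableEq ι] (L : Matrix ι ι ℝ)
    (c : ι → ℝ) (t : ℝ) (i : ι) :
    HasDerivAt (fun s : ℝ => (c ᵥ* NormedSpace.exp (s • L)) i)
      (((c ᵥ* NormedSpace.exp (t • L)) ᵥ* L) i) t := by
  rw [Matrix.vecMul_vecMul]
  exact HasDerivAt.fun_sum fun j _ => (hasDerivAt_exp_smul_apply L t j i).const_mul (c j)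

/-- The function of the state that is quadratic in the number of jobs, with coefficients `c` in
the basis of falling factorials. -/
def polyEval {d : ℕ} (c : Fin 3 × Fin d → ℝ) (x : Fin d × ℕ) : ℝ :=
  c (0, x.1) + c (1, x.1) * x.2 + c (2, x.1) * (x.2 * (x.2 - 1))

/-- The matrix of the generator of Model I on the functions `polyEval c`. -/
def momentMatrix {d : ℕ} (lam mu : Fin d → ℝ) (Q : Matrix (Fin d) (Fin d) ℝ) :
    Matrix (Fin 3 × Fin d) (Fin 3 × Fin d) ℝ :=
  fun p q => (if p.1 = q.1 then Q p.2 q.2 else 0)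
    - (if p.1 = q.1 then (if p.2 = q.2 then (p.1 : ℝ) * mu p.2 else 0) else 0)
    + (if (p.1 : ℕ) + 1 = q.1 then (if p.2 = q.2 then (q.1 : ℝ) * lam p.2 else 0) else 0)

section MomentMatrix

variable {d : ℕ} (lam mu : Fin d → ℝ) (Q : Matrix (Fin d) (Fin d) ℝ) (c : Fin 3 × Fin d → ℝ)
  (i : Fin d)

lemma momentMatrix_mulVec_zero : (momentMatrix lam mu Q *ᵥ c) (0, i)
    = ∑ j, Q i j * c (0, j) + lam i * c (1, i) := by
  simp [Matrix.mulVec, dotProduct, momentMatrix, Fintype.sum_prod_type, Fin.sum_univ_three]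

lemma momentMatrix_mulVec_one : (momentMatrix lam mu Q *ᵥ c) (1, i)
    = ∑ j, Q i j * c (1, j) - mu i * c (1, i) + 2 * lam i * c (2, i) := by
  simp [Matrix.mulVec, dotProduct, momentMatrix, Fintype.sum_prod_type, Fin.sum_univ_three,
    sub_mul]

lemma momentMatrix_mulVec_two : (momentMatrix lam mu Q *ᵥ c) (2, i)
    = ∑ j, Q i j * c (2, j) - 2 * mu i * c (2, i) := by
  simp [Matrix.mulVec, dotProduct, momentMatrix, Fintype.sum_prod_type, Fin.sum_univ_three,
    sub_mul]

lemma vecMul_momentMatrix_zero : (c ᵥ* momentMatrix lam mu Q) (0, i)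
    = ∑ j, c (0, j) * Q j i := by
  simp [Matrix.vecMul, dotProduct, momentMatrix, Fintype.sum_prod_type, Fin.sum_univ_three]

lemma vecMul_momentMatrix_one : (c ᵥ* momentMatrix lam mu Q) (1, i)
    = ∑ j, c (1, j) * Q j i - c (1, i) * mu i + c (0, i) * lam i := by
  simp [Matrix.vecMul, dotProduct, momentMatrix, Fintype.sum_prod_type, Fin.sum_univ_three,
    mul_sub]
  ring

lemma vecMul_momentMatrix_two : (c ᵥ* momentMatrix lam mu Q) (2, i)
    = ∑ j, c (2, j) * Q j i - 2 * (c (2, i) * mu i) + 2 * (c (1, i) * lam i) := by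
  simp [Matrix.vecMul, dotProduct, momentMatrix, Fintype.sum_prod_type, Fin.sum_univ_three,
    mul_sub]
  ring

/-- Closure of the moment equations: for falling factorials, (m+1)_k - (m)_k = k (m)_{k-1} and
m((m-1)_k - (m)_k) = -k (m)_k, so the degree never increases. -/
lemma gen_polyEval (x : Fin d × ℕ) :
    gen lam mu Q (polyEval c) x = polyEval (momentMatrix lam mu Q *ᵥ c) x := by
  obtain ⟨i, m⟩ := x
  have h : ∀ a b : ℝ, ∑ j, Q i j * (c (0, j) + c (1, j) * a + c (2, j) * b)
      = ∑ j, Q i j * c (0, j) + (∑ j, Q i j * c (1, j)) * a + (∑ j, Q i j * c (2, j)) * b := by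
    intro a b
    simp only [Finset.sum_mul, ← Finset.sum_add_distrib]
    exact Finset.sum_congr rfl fun j _ => by ring
  simp only [gen, polyEval, momentMatrix_mulVec_zero, momentMatrix_mulVec_one,
    momentMatrix_mulVec_two, h]
  rcases m with _ | m
  · simp; ring
  · push_cast
    ring

end MomentMatrix

lemma polyEval_neg {d : ℕ} (c : Fin 3 × Fin d → ℝ) (x : Fin d × ℕ) :
    polyEval (-c) x = -polyEval c x := by
  simp only [polyEval, Pi.neg_apply]; ring

lemma natCast_mul_sub_one_nonneg (m : ℕ) : (0 : ℝ) ≤ m * (m - 1) := by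
  rcases m with _ | m
  · simp
  · push_cast; rw [add_sub_cancel_right]; positivity

lemma abs_polyEval_le {d : ℕ} {c : Fin 3 × Fin d → ℝ} {R : ℝ} (hR : ∀ p, |c p| ≤ R)
    (x : Fin d × ℕ) : |polyEval c x| ≤ R * polyEval (fun _ => 1) x := by
  have h1 : |c (1, x.1) * x.2| ≤ R * x.2 := by
    rw [abs_mul, abs_of_nonneg (Nat.cast_nonneg x.2 : (0 : ℝ) ≤ x.2)]
    exact mul_le_mul_of_nonneg_right (hR _) (Nat.cast_nonneg _)
  have h2 : |c (2, x.1) * (x.2 * (x.2 - 1))| ≤ R * (x.2 * (x.2 - 1)) := by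
    rw [abs_mul, abs_of_nonneg (natCast_mul_sub_one_nonneg x.2)]
    exact mul_le_mul_of_nonneg_right (hR _) (natCast_mul_sub_one_nonneg _)
  refine (abs_add_three _ _ _).trans ?_
  have := hR (0, x.1)
  simp only [polyEval]
  linarith

lemma polyEval_one_le {d : ℕ} (x : Fin d × ℕ) :
    polyEval (fun _ => 1) x ≤ ((x.2 : ℝ) + 1) ^ 2 := by
  have : (0 : ℝ) ≤ x.2 := Nat.cast_nonneg _
  simp only [polyEval]; nlinarith

lemma abs_polyEval_le_sq {d : ℕ} {c : Fin 3 × Fin d → ℝ} {R : ℝ} (hR0 : 0 ≤ R)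
    (hR : ∀ p, |c p| ≤ R) (x : Fin d × ℕ) : |polyEval c x| ≤ R * ((x.2 : ℝ) + 1) ^ 2 :=
  (abs_polyEval_le hR x).trans (mul_le_mul_of_nonneg_left (polyEval_one_le x) hR0)

/-! ### Moments by truncation -/

section Moments

variable {d : ℕ} {lam mu : Fin d → ℝ} {Q : Matrix (Fin d) (Fin d) ℝ}
  {P : ℝ≥0 → Fin d × ℕ → Fin d × ℕ → ℝ}

lemma abs_polyEval_truncate_le {c : Fin 3 × Fin d → ℝ} {R : ℝ} (hR0 : 0 ≤ R)
    (hR : ∀ p, |c p| ≤ R) (n : ℕ) (y : Fin d × ℕ) :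
    |if y.2 ≤ n then polyEval c y else 0| ≤ R * ((n : ℝ) + 1) ^ 2 := by
  split_ifs with h
  · refine (abs_polyEval_le_sq hR0 hR y).trans (mul_le_mul_of_nonneg_left ?_ hR0)
    have : (y.2 : ℝ) ≤ n := by exact_mod_cast h
    gcongr
  · rw [abs_zero]; positivity

/-- The matrix exponential and the semigroup on the truncated function both solve the backward
equation. They differ initially only at states with more than n jobs, where a small multiple of
(m+1)^3 covers the difference; e^{Ct}(m+1)^3 is a supersolution. -/
lemma polyEval_sub_tsum_truncate_le (hQ : IsRateMatrix Q) (hlam : ∀ i, 0 ≤ lam i)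
    (hmu : ∀ i, 0 ≤ mu i) (hP : IsTransitionFunction (modelIRates lam mu Q) P)
    {c : Fin 3 × Fin d → ℝ} {R : ℝ} (hR0 : 0 ≤ R) (hR : ∀ p, |c p| ≤ R)
    {C : ℝ} (hC : ∀ i, 7 * lam i ≤ C) (n : ℕ) (t : ℝ≥0) (x : Fin d × ℕ) :
    polyEval (NormedSpace.exp ((t : ℝ) • momentMatrix lam mu Q) *ᵥ c) x
      - ∑' y, P t x y * (if y.2 ≤ n then polyEval c y else 0)
      ≤ R / ((n : ℝ) + 1) * Real.exp (C * t) * ((x.2 : ℝ) + 1) ^ 3 := by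
  set L := momentMatrix lam mu Q with hL
  set w : ℝ → Fin 3 × Fin d → ℝ := fun s => NormedSpace.exp (s • L) *ᵥ c with hw
  set g : Fin d × ℕ → ℝ := fun y => if y.2 ≤ n then polyEval c y else 0 with hg
  have hgB : ∀ y, |g y| ≤ R * ((n : ℝ) + 1) ^ 2 := abs_polyEval_truncate_le hR0 hR n
  -- Smallest factor with R (m+1)^2 ≤ δ (m+1)^3 for all m ≥ n.
  set δ : ℝ := R / ((n : ℝ) + 1) with hδ
  have hδ0 : 0 ≤ δ := by positivity
  set u : ℝ → Fin d × ℕ → ℝ := fun s x => ∑' y, P s.toNNReal x y * g y with hu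
  have hwd : ∀ s x, HasDerivAt (fun s => polyEval (w s) x) (polyEval (L *ᵥ w s) x) s := by
    intro s x
    exact ((hasDerivAt_exp_smul_mulVec L c s _).add
      ((hasDerivAt_exp_smul_mulVec L c s _).mul_const _)).add
      ((hasDerivAt_exp_smul_mulVec L c s _).mul_const _)
  have hed : ∀ s : ℝ, HasDerivAt (fun s => Real.exp (C * s)) (C * Real.exp (C * s)) s := by
    intro s
    have := ((hasDerivAt_id s).const_mul C).exp
    simpa [mul_comm] using this
  obtain ⟨R', hR'0, hR'⟩ : ∃ R' : ℝ, 0 ≤ R' ∧ ∀ s ∈ Set.Icc (0 : ℝ) t, ∀ p, |w s p| ≤ R' := by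
    have hc : ContinuousOn (fun s => ∑ p, |w s p|) (Set.Icc (0 : ℝ) t) := by
      refine continuousOn_finsetSum _ fun p _ => ?_
      exact (continuous_iff_continuousAt.2 fun s =>
        (hasDerivAt_exp_smul_mulVec L c s p).continuousAt).abs.continuousOn
    obtain ⟨s₀, hs₀, hmax⟩ := isCompact_Icc.exists_isMaxOn ⟨0, ⟨le_rfl, t.coe_nonneg⟩⟩ hc
    exact ⟨_, Finset.sum_nonneg fun p _ => abs_nonneg (w s₀ p), fun s hs p =>
      (Finset.single_le_sum (f := fun p => |w s p|) (fun q _ => abs_nonneg _)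
        (Finset.mem_univ p)).trans (hmax hs)⟩
  have hmain := nonpos_of_subsolution (T := t) (R := R' + R * ((n : ℝ) + 1) ^ 2) hQ hlam hmu
    (f := fun s x => polyEval (w s) x - u s x - δ * Real.exp (C * s) * ((x.2 : ℝ) + 1) ^ 3)
    (f' := fun s x => polyEval (L *ᵥ w s) x - gen lam mu Q (u s) x
      - δ * (C * Real.exp (C * s)) * ((x.2 : ℝ) + 1) ^ 3) ?_ ?_ ?_ ?_ ?_ t
      ⟨t.coe_nonneg, le_rfl⟩ x
  · simp only [hu, Real.toNNReal_coe] at hmain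
    linarith
  · intro x
    refine Continuous.continuousOn ?_
    have h1 : Continuous fun s => polyEval (w s) x :=
      continuous_iff_continuousAt.2 fun s => (hwd s x).continuousAt
    have h2 : Continuous fun s => u s x := (hP.continuous_tsum hgB x).comp continuous_real_toNNReal
    fun_prop
  · intro s hs x
    exact ((hwd s x).sub (hP.hasDerivAt_tsum hQ hgB hs.1 x)).sub
      (((hed s).const_mul δ).mul_const _)
  · intro s hs x
    rw [gen_sub, gen_sub, gen_polyEval, gen_smul]
    have h1 := gen_cube_le hQ hmu hlam hC x
    have h2 := mul_le_mul_of_nonneg_left h1 (mul_nonneg hδ0 (Real.exp_pos (C * s)).le)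
    have h3 : δ * Real.exp (C * s) * (C * ((x.2 : ℝ) + 1) ^ 3)
      = δ * (C * Real.exp (C * s)) * ((x.2 : ℝ) + 1) ^ 3 := by ring
    linarith
  · intro x
    have h1 : w 0 = c := by simp [hw]
    simp only [h1, hu, Real.toNNReal_zero, hP.tsum_zero, mul_zero, Real.exp_zero, mul_one, hg]
    split_ifs with h
    · rw [sub_self, zero_sub, neg_nonpos]; positivity
    · have h2 := (le_abs_self _).trans (abs_polyEval_le_sq hR0 hR x)
      have h3 : ((n : ℝ) + 1) ≤ (x.2 : ℝ) + 1 := by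
        have : (n : ℝ) ≤ x.2 := by exact_mod_cast (not_le.1 h).le
        linarith
      have h4 : R * ((x.2 : ℝ) + 1) ^ 2 ≤ δ * ((x.2 : ℝ) + 1) ^ 3 := by
        rw [hδ, div_mul_eq_mul_div, le_div_iff₀ (by positivity)]
        calc _ ≤ R * ((x.2 : ℝ) + 1) ^ 2 * ((x.2 : ℝ) + 1) :=
              mul_le_mul_of_nonneg_left h3 (by positivity)
          _ = _ := by ring
      linarith
  · intro s hs x
    have h1 := (le_abs_self _).trans (abs_polyEval_le_sq hR'0 (hR' s hs) x)
    have h2 := (neg_le_abs _).trans (hP.abs_tsum_le hgB s.toNNReal x)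
    have h3 : R * ((n : ℝ) + 1) ^ 2 ≤ R * ((n : ℝ) + 1) ^ 2 * ((x.2 : ℝ) + 1) ^ 2 := by
      refine le_mul_of_one_le_right (by positivity) (one_le_pow₀ ?_)
      linarith [(Nat.cast_nonneg x.2 : (0 : ℝ) ≤ x.2)]
    have h4 : 0 ≤ δ * Real.exp (C * s) * ((x.2 : ℝ) + 1) ^ 3 := by positivity
    simp only [hu]
    linarith

lemma tendsto_tsum_truncate (hQ : IsRateMatrix Q) (hlam : ∀ i, 0 ≤ lam i)
    (hmu : ∀ i, 0 ≤ mu i) (hP : IsTransitionFunction (modelIRates lam mu Q) P)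
    (c : Fin 3 × Fin d → ℝ) (t : ℝ≥0) (x : Fin d × ℕ) :
    Tendsto (fun n : ℕ => ∑' y, P t x y * (if y.2 ≤ n then polyEval c y else 0)) atTop
      (𝓝 (polyEval (NormedSpace.exp ((t : ℝ) • momentMatrix lam mu Q) *ᵥ c) x)) := by
  set R : ℝ := ∑ p, |c p| with hR
  have hR0 : 0 ≤ R := Finset.sum_nonneg fun p _ => abs_nonneg _
  have hRc : ∀ p, |c p| ≤ R := fun p =>
    Finset.single_le_sum (f := fun p => |c p|) (fun q _ => abs_nonneg _) (Finset.mem_univ p)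
  obtain ⟨C, hC⟩ : ∃ C : ℝ, ∀ i, 7 * lam i ≤ C :=
    ⟨∑ i, 7 * lam i, fun i => Finset.single_le_sum (f := fun i => 7 * lam i)
      (fun j _ => mul_nonneg (by norm_num) (hlam j)) (Finset.mem_univ i)⟩
  rw [tendsto_iff_norm_sub_tendsto_zero]
  have hlim : Tendsto (fun n : ℕ => R / ((n : ℝ) + 1) * Real.exp (C * t) * ((x.2 : ℝ) + 1) ^ 3)
      atTop (𝓝 0) := by
    have h1 : Tendsto (fun n : ℕ => R / ((n : ℝ) + 1)) atTop (𝓝 0) :=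
      tendsto_const_nhds.div_atTop
        (tendsto_atTop_add_const_right _ _ tendsto_natCast_atTop_atTop)
    simpa using (h1.mul_const (Real.exp (C * t))).mul_const (((x.2 : ℝ) + 1) ^ 3)
  refine squeeze_zero (fun _ => norm_nonneg _) (fun n => ?_) hlim
  have h1 := polyEval_sub_tsum_truncate_le hQ hlam hmu hP hR0 hRc hC n t x
  -- The one-sided estimate for `-c` supplies the opposite inequality.
  have h2 := polyEval_sub_tsum_truncate_le hQ hlam hmu hP hR0 (c := -c)
    (fun p => by simpa using hRc p) hC n t x
  have h3 : ∀ y : Fin d × ℕ, P t x y * (if y.2 ≤ n then polyEval (-c) y else 0)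
      = -(P t x y * (if y.2 ≤ n then polyEval c y else 0)) := fun y => by
    rw [polyEval_neg]; split_ifs <;> ring
  rw [Matrix.mulVec_neg, polyEval_neg] at h2
  simp only [h3, tsum_neg] at h2
  rw [Real.norm_eq_abs, abs_le]
  constructor <;> linarith

/-- Moments of degree at most two are given by the exponential of the moment matrix. -/
theorem IsTransitionFunction.hasSum_polyEval (hQ : IsRateMatrix Q) (hlam : ∀ i, 0 ≤ lam i)
    (hmu : ∀ i, 0 ≤ mu i) (hP : IsTransitionFunction (modelIRates lam mu Q) P)
    (c : Fin 3 × Fin d → ℝ) (t : ℝ≥0) (x : Fin d × ℕ) :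
    HasSum (fun y => P t x y * polyEval c y)
      (polyEval (NormedSpace.exp ((t : ℝ) • momentMatrix lam mu Q) *ᵥ c) x) := by
  have hone : ∀ y : Fin d × ℕ, 0 ≤ polyEval (fun _ => 1) y := fun y => by
    have := natCast_mul_sub_one_nonneg y.2
    simp only [polyEval]; positivity
  -- The coefficients identically 1 give a nonnegative function whose partial sums are bounded
  -- through the truncations. It then dominates every other `polyEval c`.
  have hsum1 : Summable fun y => P t x y * polyEval (fun _ => 1) y := by
    refine summable_of_sum_le (c := polyEval (NormedSpace.exp
      ((t : ℝ) • momentMatrix lam mu Q) *ᵥ fun _ => 1) x)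
      (fun y => mul_nonneg (hP.nonneg t x y) (hone y)) fun s => ?_
    refine ge_of_tendsto (tendsto_tsum_truncate hQ hlam hmu hP (fun _ => 1) t x) ?_
    filter_upwards [eventually_ge_atTop (s.sup Prod.snd)] with n hn
    have hs : ∑ y ∈ s, P t x y * polyEval (fun _ => 1) y
        = ∑ y ∈ s, P t x y * (if y.2 ≤ n then polyEval (fun _ => 1) y else 0) := by
      refine Finset.sum_congr rfl fun y hy => ?_
      rw [if_pos ((Finset.le_sup (f := Prod.snd) hy).trans hn)]
    rw [hs]
    refine Summable.sum_le_tsum s (fun y _ => mul_nonneg (hP.nonneg t x y) ?_)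
      (hP.summable_mul (abs_polyEval_truncate_le zero_le_one (fun _ => by simp) n) t x)
    split_ifs
    exacts [hone y, le_rfl]
  set R : ℝ := ∑ p, |c p| with hR
  have hRc : ∀ p, |c p| ≤ R := fun p =>
    Finset.single_le_sum (f := fun p => |c p|) (fun q _ => abs_nonneg _) (Finset.mem_univ p)
  have hbound : ∀ y, ‖P t x y * polyEval c y‖ ≤ R * (P t x y * polyEval (fun _ => 1) y) := by
    intro y
    rw [Real.norm_eq_abs, abs_mul, abs_of_nonneg (hP.nonneg t x y), mul_left_comm]
    exact mul_le_mul_of_nonneg_left (abs_polyEval_le hRc y) (hP.nonneg t x y)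
  have hsum : Summable fun y => P t x y * polyEval c y :=
    Summable.of_norm_bounded (hsum1.mul_left R) hbound
  have hlim : Tendsto (fun n : ℕ => ∑' y, P t x y * (if y.2 ≤ n then polyEval c y else 0)) atTop
      (𝓝 (∑' y, P t x y * polyEval c y)) := by
    refine tendsto_tsum_of_dominated_convergence (hsum1.mul_left R) (fun y => ?_)
      (Eventually.of_forall fun n y => ?_)
    · refine tendsto_const_nhds.congr' ?_
      filter_upwards [eventually_ge_atTop y.2] with n hn
      rw [if_pos hn]
    · refine le_trans ?_ (hbound y)
      split_ifs
      · exact le_rfl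
      · simp only [mul_zero, norm_zero]; positivity
  rw [← tendsto_nhds_unique hlim (tendsto_tsum_truncate hQ hlam hmu hP c t x)]
  exact hsum.hasSum

end Moments

/-! ### Laws, expectations and the covariance formula -/

/-- Expectation of a function of a discrete random variable. -/
lemma integrable_and_integral_eq_of_hasSum {S : Type*} [Countable S] [MeasurableSpace S]
    [MeasurableSingletonClass S] {Ω : Type*} [MeasurableSpace Ω] {Pr : Measure Ω}
    [IsFiniteMeasure Pr] {Y : Ω → S} (hY : Measurable Y) {G : S → ℝ} {a : ℝ}
    (h : HasSum (fun y => Pr.real (Y ⁻¹' {y}) * G y) a) :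
    Integrable (fun ω => G (Y ω)) Pr ∧ ∫ ω, G (Y ω) ∂Pr = a := by
  have hG : Measurable G := measurable_of_countable G
  have hreal : ∀ y, (Pr.map Y).real {y} = Pr.real (Y ⁻¹' {y}) := fun y => by
    rw [map_measureReal_apply hY (measurableSet_singleton y)]
  have hint : Integrable G (Pr.map Y) := by
    refine ⟨hG.aestronglyMeasurable, ?_⟩
    rw [HasFiniteIntegral, lintegral_countable']
    have hterm : ∀ y, ‖G y‖ₑ * (Pr.map Y) {y} = ENNReal.ofReal (|Pr.real (Y ⁻¹' {y}) * G y|) := by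
      intro y
      rw [abs_mul, abs_of_nonneg measureReal_nonneg, mul_comm,
        ENNReal.ofReal_mul measureReal_nonneg, ← hreal, ofReal_measureReal,
        Real.enorm_eq_ofReal_abs]
    simp only [hterm]
    exact h.summable.abs.tsum_ofReal_lt_top
  refine ⟨(integrable_map_measure hG.aestronglyMeasurable hY.aemeasurable).1 hint, ?_⟩
  rw [← integral_map hY.aemeasurable hG.aestronglyMeasurable, integral_countable hint, ← h.tsum_eq]
  exact tsum_congr fun y => by rw [hreal, smul_eq_mul]

/-- A solution of a linear differential equation that starts at zero vanishes. -/
lemma eq_zero_of_hasDerivAt_mulVec {ι : Type*} [Fintype ι] (L : Matrix ι ι ℝ) {x : ℝ → ι → ℝ}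
    (hx : ∀ t i, HasDerivAt (fun s => x s i) ((L *ᵥ x t) i) t) (h0 : x 0 = 0) (t : ℝ) :
    x t = 0 := by
  set v := LinearMap.toContinuousLinearMap (Matrix.mulVecLin L) with hv
  have h := ODE_solution_unique_univ (v := fun _ => v) (s := fun _ => Set.univ) (t₀ := 0)
    (K := ‖v‖₊) (f := x) (g := fun _ => 0) (fun _ => v.lipschitz.lipschitzOnWith)
    (fun t => ⟨hasDerivAt_pi.2 (hx t), trivial⟩)
    (fun t => ⟨by simpa using hasDerivAt_const t (0 : ι → ℝ), trivial⟩) h0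
  rw [h]

/-- The factorial moments of the initial distribution. -/
def initialRow {d : ℕ} (π : Fin d → ℝ) (p : Fin 3 × Fin d) : ℝ := if p.1 = 0 then π p.2 else 0

/-- The coefficients of the number of jobs. -/
def jobsColumn {d : ℕ} (p : Fin 3 × Fin d) : ℝ := if p.1 = 1 then 1 else 0

/-- Factorial moments of the number of jobs at time `t`, jointly with the background state. -/
def momentRow {d : ℕ} (lam mu : Fin d → ℝ) (Q : Matrix (Fin d) (Fin d) ℝ) (π : Fin d → ℝ)
    (t : ℝ) : Fin 3 × Fin d → ℝ :=
  initialRow π ᵥ* NormedSpace.exp (t • momentMatrix lam mu Q)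

/-- Coefficients of the conditional mean number of jobs a time `t` ahead. -/
def meanColumn {d : ℕ} (lam mu : Fin d → ℝ) (Q : Matrix (Fin d) (Fin d) ℝ) (t : ℝ) :
    Fin 3 × Fin d → ℝ :=
  NormedSpace.exp (t • momentMatrix lam mu Q) *ᵥ jobsColumn

section Columns

variable {d : ℕ} (lam mu : Fin d → ℝ) (Q : Matrix (Fin d) (Fin d) ℝ) {π : Fin d → ℝ}

lemma hasDerivAt_momentRow (π : Fin d → ℝ) (t : ℝ) (p : Fin 3 × Fin d) :
    HasDerivAt (fun s => momentRow lam mu Q π s p)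
      ((momentRow lam mu Q π t ᵥ* momentMatrix lam mu Q) p) t :=
  hasDerivAt_vecMul_exp_smul _ _ t p

lemma hasDerivAt_meanColumn (t : ℝ) (p : Fin 3 × Fin d) :
    HasDerivAt (fun s => meanColumn lam mu Q s p)
      ((momentMatrix lam mu Q *ᵥ meanColumn lam mu Q t) p) t :=
  hasDerivAt_exp_smul_mulVec _ _ t p

lemma momentRow_zero (π : Fin d → ℝ) : momentRow lam mu Q π 0 = initialRow π := by
  simp [momentRow]

lemma meanColumn_zero : meanColumn lam mu Q 0 = jobsColumn := by
  simp [meanColumn]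

lemma momentRow_apply_zero (hπ : π ᵥ* Q = 0) (t : ℝ) (i : Fin d) :
    momentRow lam mu Q π t (0, i) = π i := by
  have h := eq_zero_of_hasDerivAt_mulVec Qᵀ
    (x := fun t i => momentRow lam mu Q π t (0, i) - π i) (fun t i => ?_) ?_ t
  · exact sub_eq_zero.1 (congrFun h i)
  · have h1 := (hasDerivAt_momentRow lam mu Q π t (0, i)).sub_const (π i)
    rw [vecMul_momentMatrix_zero] at h1
    have h2 : ∑ j, π j * Q j i = 0 := congrFun hπ i
    refine h1.congr_deriv ?_
    show _ = ∑ j, Q j i * (momentRow lam mu Q π t (0, j) - π j)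
    rw [← sub_zero (∑ j, _), ← h2, ← Finset.sum_sub_distrib]
    exact Finset.sum_congr rfl fun j _ => by ring
  · ext i
    simp [momentRow_zero, initialRow]

/-- Given the state, the mean number of jobs later on is affine in the present number: the quadratic
coefficients solve a homogeneous equation and start at zero. -/
lemma meanColumn_apply_two (t : ℝ) (i : Fin d) : meanColumn lam mu Q t (2, i) = 0 := by
  have h := eq_zero_of_hasDerivAt_mulVec (Q - 2 • Matrix.diagonal mu)
    (x := fun t i => meanColumn lam mu Q t (2, i)) (fun t i => ?_) ?_ t
  · exact congrFun h i
  · have h1 := hasDerivAt_meanColumn lam mu Q t (2, i)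
    rw [momentMatrix_mulVec_two] at h1
    convert h1 using 1
    rw [Matrix.sub_mulVec, Matrix.smul_mulVec, Pi.sub_apply, Pi.smul_apply, Matrix.mulVec_diagonal,
      nsmul_eq_mul]
    simp only [Matrix.mulVec, dotProduct]
    push_cast; ring
  · ext i
    simp [meanColumn_zero, jobsColumn]

end Columns

section Law

variable {d : ℕ} {lam mu : Fin d → ℝ} {Q : Matrix (Fin d) (Fin d) ℝ} {π : Fin d → ℝ}
  {Ω : Type*} [MeasurableSpace Ω] {Pr : Measure Ω} [IsProbabilityMeasure Pr]

/-- Almost surely `Y` lies in `F`. Additivity is applied to the restriction of the measure to `E`,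
so `E` need not be measurable. -/
lemma measureReal_eq_sum_inter_preimage {S : Type*} [MeasurableSpace S]
    [MeasurableSingletonClass S] {Y : Ω → S} (hY : Measurable Y) (F : Finset S)
    (hF : ∑ y ∈ F, Pr.real (Y ⁻¹' {y}) = 1) (E : Set Ω) :
    Pr.real E = ∑ y ∈ F, Pr.real (Y ⁻¹' {y} ∩ E) := by
  have hm : MeasurableSet (Y ⁻¹' (F : Set S)) := hY F.measurableSet
  rw [sum_measureReal_preimage_singleton F (fun y _ => hY (measurableSet_singleton y))] at hF
  have hnull : Pr (Y ⁻¹' (F : Set S))ᶜ = 0 := by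
    have := probReal_compl_eq_one_sub (μ := Pr) hm
    rw [hF, sub_self] at this
    exact (measureReal_eq_zero_iff).1 this
  have h1 : ∀ y ∈ F, Pr.real (Y ⁻¹' {y} ∩ E) = (Pr.restrict E).real (Y ⁻¹' {y}) := fun y _ => by
    rw [measureReal_restrict_apply (hY (measurableSet_singleton y))]
  rw [Finset.sum_congr rfl h1,
    sum_measureReal_preimage_singleton F (fun y _ => hY (measurableSet_singleton y)),
    measureReal_restrict_apply hm]
  refine measureReal_congr ?_
  have : ∀ᵐ ω ∂Pr, ω ∈ Y ⁻¹' (F : Set S) := by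
    rw [ae_iff]; exact hnull
  filter_upwards [this] with ω hω
  exact propext ⟨fun h => ⟨hω, h⟩, fun h => h.2⟩

/-- One- and two-dimensional distributions of Model I. -/
lemma exists_transitionFunction_of_isModelI {J : ℝ≥0 → Ω → Fin d} {M : ℝ≥0 → Ω → ℕ}
    (hsum : ∑ i, π i = 1) (hM : IsModelI lam mu Q π Pr J M) :
    ∃ P, IsTransitionFunction (modelIRates lam mu Q) P ∧
      ∀ t u x y, Pr.real ((fun ω => ((J t ω, M t ω), (J (t + u) ω, M (t + u) ω))) ⁻¹' {(x, y)})
        = (∑ i, π i * P t (i, 0) x) * P u x y := by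
  obtain ⟨hmeas, P, hP, hfdd⟩ := hM
  refine ⟨P, hP, fun t u x y => ?_⟩
  set ι : Fin d ↪ Fin d × ℕ := ⟨fun i => (i, 0), fun i j h => (Prod.mk.inj h).1⟩
  have hι : ∀ i, ι i = (i, 0) := fun _ => rfl
  have h0 : ∀ i, Pr.real ((fun ω => (J 0 ω, M 0 ω)) ⁻¹' {(i, 0)}) = π i := by
    intro i
    have h := hfdd 0 (fun _ => 0) (fun _ => (i, 0)) (fun _ _ _ => le_rfl) rfl
    simp only [nonpos_iff_eq_zero, forall_eq, Finset.range_zero, Finset.prod_empty, mul_one,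
      if_true] at h
    exact h
  rw [measureReal_eq_sum_inter_preimage (hmeas 0) (Finset.univ.map ι)
    (by simpa only [Finset.sum_map, hι, h0] using hsum), Finset.sum_map, Finset.sum_mul]
  refine Finset.sum_congr rfl fun i _ => ?_
  -- The times are 0, t, t+u, continued by the constant t+u to keep the sequence monotone.
  have h2 := hfdd 2 (fun k => if k = 0 then 0 else if k = 1 then t else t + u)
    (fun k => if k = 0 then (i, 0) else if k = 1 then x else y) ?_ rfl
  · simp only [Finset.prod_range_succ, Finset.prod_range_zero] at h2
    simp at h2
    rw [← mul_assoc] at h2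
    rw [← h2]
    congr 1
    ext ω
    simp only [Set.mem_inter_iff, Set.mem_preimage, Set.mem_singleton_iff, Set.mem_ofPred_eq, hι]
    constructor
    · rintro ⟨h1, h3⟩ k hk
      rw [Prod.mk.injEq] at h3
      interval_cases k
      · simpa using h1
      · simpa using h3.1
      · simpa using h3.2
    · intro h
      have e0 := h 0 (by norm_num)
      have e1 := h 1 (by norm_num)
      have e2 := h 2 (by norm_num)
      simp only [if_true, one_ne_zero, if_false, OfNat.ofNat_ne_zero, OfNat.ofNat_ne_one] at e0 e1 e2
      exact ⟨e0, by rw [Prod.mk.injEq]; exact ⟨e1, e2⟩⟩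
  · refine monotone_nat_of_le_succ fun k => ?_
    rcases k with _ | _ | k
    · simp
    · simp
    · simp

end Law

section Covariance

variable {d : ℕ} {lam mu : Fin d → ℝ} {Q : Matrix (Fin d) (Fin d) ℝ} {π : Fin d → ℝ}
  {Ω : Type*} [MeasurableSpace Ω] {Pr : Measure Ω}
  {J : ℝ≥0 → Ω → Fin d} {M : ℝ≥0 → Ω → ℕ}

lemma IsModelI.measurable (hM : IsModelI lam mu Q π Pr J M) (t : ℝ≥0) :
    Measurable fun ω => (J t ω, M t ω) := hM.1 t

lemma polyEval_jobsColumn (x : Fin d × ℕ) : polyEval jobsColumn x = x.2 := by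
  simp [polyEval, jobsColumn]

lemma hasSum_sum_mul_polyEval (hQ : IsRateMatrix Q) (hlam : ∀ i, 0 ≤ lam i)
    (hmu : ∀ i, 0 ≤ mu i) {P : ℝ≥0 → Fin d × ℕ → Fin d × ℕ → ℝ}
    (hP : IsTransitionFunction (modelIRates lam mu Q) P) (c : Fin 3 × Fin d → ℝ) (t : ℝ≥0) :
    HasSum (fun x => (∑ i, π i * P t (i, 0) x) * polyEval c x)
      (momentRow lam mu Q π t ⬝ᵥ c) := by
  have h1 := hasSum_sum (s := Finset.univ)
    fun (i : Fin d) _ => (hP.hasSum_polyEval hQ hlam hmu c t (i, 0)).mul_left (π i)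
  have h2 : momentRow lam mu Q π t ⬝ᵥ c
      = ∑ i, π i * polyEval (NormedSpace.exp ((t : ℝ) • momentMatrix lam mu Q) *ᵥ c) (i, 0) := by
    rw [momentRow, ← Matrix.dotProduct_mulVec]
    simp only [dotProduct, initialRow, Fintype.sum_prod_type, Fin.sum_univ_three, polyEval]
    simp
  rw [h2]
  refine (congrArg (fun f => HasSum f _) (funext fun x => ?_)).mpr h1
  rw [Finset.sum_mul]
  exact Finset.sum_congr rfl fun i _ => mul_assoc _ _ _

variable [IsProbabilityMeasure Pr]

lemma IsModelI.integral_polyEval (hQ : IsRateMatrix Q) (hlam : ∀ i, 0 ≤ lam i)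
    (hmu : ∀ i, 0 ≤ mu i) (hπ : ∑ i, π i = 1) (hM : IsModelI lam mu Q π Pr J M)
    (c : Fin 3 × Fin d → ℝ) (t : ℝ≥0) :
    Integrable (fun ω => polyEval c (J t ω, M t ω)) Pr ∧
      ∫ ω, polyEval c (J t ω, M t ω) ∂Pr = momentRow lam mu Q π t ⬝ᵥ c := by
  obtain ⟨P, hP, hlaw⟩ := exists_transitionFunction_of_isModelI hπ hM
  refine integrable_and_integral_eq_of_hasSum (hM.measurable t) ?_
  convert hasSum_sum_mul_polyEval hQ hlam hmu hP c t using 1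
  ext x
  -- Lag zero turns the two-dimensional law into the law at time t.
  have h := hlaw t 0 x x
  rw [hP.zero, if_pos rfl, mul_one] at h
  rw [← h]
  congr 2
  ext ω
  simp

lemma IsModelI.memLp_two (hQ : IsRateMatrix Q) (hlam : ∀ i, 0 ≤ lam i)
    (hmu : ∀ i, 0 ≤ mu i) (hπ : ∑ i, π i = 1) (hM : IsModelI lam mu Q π Pr J M) (t : ℝ≥0) :
    MemLp (fun ω => (M t ω : ℝ)) 2 Pr := by
  have hmeas : Measurable fun ω => (M t ω : ℝ) :=
    (measurable_of_countable (fun n : ℕ => (n : ℝ))).comp (hM.measurable t).snd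
  rw [memLp_two_iff_integrable_sq hmeas.aestronglyMeasurable]
  -- These coefficients express m² = m + m(m-1).
  have h := (hM.integral_polyEval hQ hlam hmu hπ (fun p => if p.1 = 0 then 0 else 1) t).1
  refine h.congr (Eventually.of_forall fun ω => ?_)
  simp [polyEval]
  ring

lemma IsModelI.integral_jobs (hQ : IsRateMatrix Q) (hlam : ∀ i, 0 ≤ lam i)
    (hmu : ∀ i, 0 ≤ mu i) (hπ : ∑ i, π i = 1) (hM : IsModelI lam mu Q π Pr J M) (t : ℝ≥0) :
    ∫ ω, (M t ω : ℝ) ∂Pr = ∑ i, momentRow lam mu Q π t (1, i) := by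
  have h := (hM.integral_polyEval hQ hlam hmu hπ jobsColumn t).2
  simp only [polyEval_jobsColumn] at h
  rw [h]
  simp [dotProduct, jobsColumn, Fintype.sum_prod_type, Fin.sum_univ_three]

lemma IsModelI.integral_jobs_mul (hQ : IsRateMatrix Q) (hlam : ∀ i, 0 ≤ lam i)
    (hmu : ∀ i, 0 ≤ mu i) (hπ : IsInvariantProb Q π) (hM : IsModelI lam mu Q π Pr J M)
    (t u : ℝ≥0) :
    ∫ ω, (M t ω : ℝ) * M (t + u) ω ∂Pr
      = ∑ i, (momentRow lam mu Q π t (1, i) + momentRow lam mu Q π t (2, i))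
          * meanColumn lam mu Q u (1, i)
        + ∑ i, momentRow lam mu Q π t (1, i) * meanColumn lam mu Q u (0, i) := by
  obtain ⟨P, hP, hlaw⟩ := exists_transitionFunction_of_isModelI hπ.sum_eq_one hM
  set W := meanColumn lam mu Q u with hW
  -- Conditionally on the state at time t the later mean is W₀ + W₁ m, and m (W₀ + W₁ m) = (W₀ + W₁)
  -- m + W₁ m(m-1).
  set c : Fin 3 × Fin d → ℝ := fun p =>
    if p.1 = 0 then 0 else if p.1 = 1 then W (0, p.2) + W (1, p.2) else W (1, p.2) with hc
  set p : Fin d × ℕ → ℝ := fun x => ∑ i, π i * P t (i, 0) x with hp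
  have hp0 : ∀ x, 0 ≤ p x := fun x =>
    Finset.sum_nonneg fun i _ => mul_nonneg (hπ.nonneg i) (hP.nonneg _ _ _)
  have hout : HasSum (fun x => p x * polyEval c x) (momentRow lam mu Q π t ⬝ᵥ c) :=
    hasSum_sum_mul_polyEval hQ hlam hmu hP c t
  have hin : ∀ x : Fin d × ℕ, HasSum (fun y : Fin d × ℕ => p x * P u x y * ((x.2 : ℝ) * y.2))
      (p x * polyEval c x) := by
    intro x
    have h1 := ((hP.hasSum_polyEval hQ hlam hmu jobsColumn u x).mul_left ((x.2 : ℝ))).mul_left (p x)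
    simp only [polyEval_jobsColumn] at h1
    have h2 : polyEval c x = (x.2 : ℝ) * polyEval W x := by
      have h2 : W (2, x.1) = 0 := meanColumn_apply_two lam mu Q u x.1
      simp [polyEval, hc, h2]
      ring
    rw [h2]
    exact (congrArg (fun f => HasSum f _) (funext fun y => by ring)).mpr h1
  have hsum : Summable fun z : (Fin d × ℕ) × (Fin d × ℕ) =>
      p z.1 * P u z.1 z.2 * ((z.1.2 : ℝ) * z.2.2) := by
    rw [summable_prod_of_nonneg fun z => mul_nonneg (mul_nonneg (hp0 _) (hP.nonneg _ _ _))
      (mul_nonneg (Nat.cast_nonneg _) (Nat.cast_nonneg _))]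
    exact ⟨fun x => (hin x).summable, hout.summable.congr fun x => (hin x).tsum_eq.symm⟩
  have htot := hsum.hasSum
  rw [(htot.prod_fiberwise hin).unique hout] at htot
  have h := (integrable_and_integral_eq_of_hasSum (Pr := Pr)
    ((hM.measurable t).prodMk (hM.measurable (t + u)))
    (G := fun z => (z.1.2 : ℝ) * z.2.2) (a := momentRow lam mu Q π t ⬝ᵥ c) (by
      convert htot using 1
      ext z
      rw [← hlaw t u z.1 z.2])).2
  rw [h]
  simp only [dotProduct, Fintype.sum_prod_type, Fin.sum_univ_three, hc,
    ← Finset.sum_add_distrib]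
  refine Finset.sum_congr rfl fun i _ => ?_
  simp
  ring

/-- The covariance of the number of jobs at two times, in terms of factorial moments and
conditional means. -/
theorem IsModelI.covariance_eq (hQ : IsRateMatrix Q) (hlam : ∀ i, 0 ≤ lam i)
    (hmu : ∀ i, 0 ≤ mu i) (hπ : IsInvariantProb Q π) (hM : IsModelI lam mu Q π Pr J M)
    (t u : ℝ≥0) :
    covariance (fun ω => (M t ω : ℝ)) (fun ω => (M (t + u) ω : ℝ)) Pr
      = ∑ i, (momentRow lam mu Q π t (1, i) + momentRow lam mu Q π t (2, i))
          * meanColumn lam mu Q u (1, i)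
        + ∑ i, momentRow lam mu Q π t (1, i) * meanColumn lam mu Q u (0, i)
        - (∑ i, momentRow lam mu Q π t (1, i))
          * (∑ i, momentRow lam mu Q π t (1, i) * meanColumn lam mu Q u (1, i)
            + ∑ i, π i * meanColumn lam mu Q u (0, i)) := by
  rw [covariance_eq_sub (hM.memLp_two hQ hlam hmu hπ.sum_eq_one t)
    (hM.memLp_two hQ hlam hmu hπ.sum_eq_one (t + u))]
  have h1 := hM.integral_jobs_mul hQ hlam hmu hπ t u
  have h3 : ∑ i, momentRow lam mu Q π (t + u : ℝ≥0) (1, i)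
      = ∑ i, momentRow lam mu Q π t (1, i) * meanColumn lam mu Q u (1, i)
        + ∑ i, π i * meanColumn lam mu Q u (0, i) := by
    have h4 : ∑ i, momentRow lam mu Q π (t + u : ℝ≥0) (1, i)
        = momentRow lam mu Q π (t + u : ℝ≥0) ⬝ᵥ jobsColumn := by
      simp [dotProduct, jobsColumn, Fintype.sum_prod_type, Fin.sum_univ_three]
    have h5 : momentRow lam mu Q π (t + u : ℝ≥0) ⬝ᵥ jobsColumn
        = momentRow lam mu Q π t ⬝ᵥ meanColumn lam mu Q u := by
      rw [momentRow, momentRow, meanColumn, NNReal.coe_add, add_smul,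
        Matrix.exp_add_of_commute _ _ (((Commute.refl _).smul_left _).smul_right _),
        ← Matrix.vecMul_vecMul, ← Matrix.dotProduct_mulVec]
    rw [h4, h5]
    simp [dotProduct, Fintype.sum_prod_type, Fin.sum_univ_three, meanColumn_apply_two,
      momentRow_apply_zero lam mu Q hπ.invariant]
    ring
  rw [hM.integral_jobs hQ hlam hmu hπ.sum_eq_one, hM.integral_jobs hQ hlam hmu hπ.sum_eq_one, h3]
  simp only [Pi.mul_apply, h1]

end Covariance

/-! ### Spectral gap and time reversal -/

/-- `A` is the generator of a process with stationary distribution `π` and spectral gap at least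
`γ > 0` in `ℓ²(π)`. -/
structure HasSpectralGap {d : ℕ} (π : Fin d → ℝ) (A : Matrix (Fin d) (Fin d) ℝ) (γ : ℝ) : Prop where
  pos : ∀ i, 0 < π i
  sum_eq_one : ∑ i, π i = 1
  gap_pos : 0 < γ
  row_sum : ∀ i, ∑ j, A i j = 0
  col_sum : ∀ j, ∑ i, π i * A i j = 0
  dissipative : ∀ x : Fin d → ℝ, ∑ i, π i * (x i * ∑ j, A i j * x j) ≤ 0
  gap : ∀ x : Fin d → ℝ, ∑ i, π i * x i = 0 →
    ∑ i, π i * (x i * ∑ j, A i j * x j) ≤ -γ * ∑ i, π i * x i ^ 2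

section Poincare

variable {d : ℕ} {Q : Matrix (Fin d) (Fin d) ℝ} {π : Fin d → ℝ}

/-- Zeros of π spread backwards along jumps: if π_b = 0, the invariance equation at b is a vanishing
sum of nonnegative terms. Irreducibility would then make π vanish everywhere. -/
lemma IsInvariantProb.pos (hQ : IsRateMatrix Q) (hirr : IsIrreducibleRate Q)
    (hπ : IsInvariantProb Q π) (i : Fin d) : 0 < π i := by
  by_contra hi
  have hi0 : π i = 0 := le_antisymm (not_lt.1 hi) (hπ.nonneg i)
  have hall : ∀ j, π j = 0 := by
    intro j
    refine Relation.ReflTransGen.head_induction_on (motive := fun a _ => π a = 0)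
      (hirr j i) hi0 ?_
    intro a b hab _ hb
    have h1 : ∑ k, π k * Q k b = 0 := congrFun hπ.invariant b
    have h2 : ∀ k ∈ Finset.univ, 0 ≤ π k * Q k b := by
      intro k _
      rcases eq_or_ne k b with rfl | hk
      · rw [hb, zero_mul]
      · exact mul_nonneg (hπ.nonneg k) (hQ.off_diag_nonneg _ _ hk)
    have h3 := (Finset.sum_eq_zero_iff_of_nonneg h2).1 h1 a (Finset.mem_univ a)
    exact (mul_eq_zero.1 h3).resolve_right hab.ne'
  have := hπ.sum_eq_one
  simp [hall] at this

/-- The Dirichlet form. -/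
lemma two_mul_sum_mul_eq_neg_dirichlet (hQ : IsRateMatrix Q) (hπ : IsInvariantProb Q π)
    (x : Fin d → ℝ) :
    2 * ∑ i, π i * (x i * ∑ j, Q i j * x j) = -∑ i, ∑ j, π i * Q i j * (x i - x j) ^ 2 := by
  have h1 : ∑ i, ∑ j, π i * Q i j * x i ^ 2 = 0 := by
    refine Finset.sum_eq_zero fun i _ => ?_
    rw [← Finset.sum_mul, ← Finset.mul_sum, hQ.row_sum]; simp
  have h2 : ∑ i, ∑ j, π i * Q i j * x j ^ 2 = 0 := by
    rw [Finset.sum_comm]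
    refine Finset.sum_eq_zero fun j _ => ?_
    have : ∑ i, π i * Q i j = 0 := congrFun hπ.invariant j
    rw [← Finset.sum_mul, this, zero_mul]
  have h3 : ∑ i, ∑ j, π i * Q i j * (x i - x j) ^ 2
      = ∑ i, ∑ j, π i * Q i j * x i ^ 2 + ∑ i, ∑ j, π i * Q i j * x j ^ 2
        - 2 * ∑ i, π i * (x i * ∑ j, Q i j * x j) := by
    simp only [Finset.mul_sum, ← Finset.sum_add_distrib, ← Finset.sum_sub_distrib]
    exact Finset.sum_congr rfl fun i _ => Finset.sum_congr rfl fun j _ => by ring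
  rw [h3, h1, h2]; ring

lemma dirichlet_term_nonneg (hQ : IsRateMatrix Q) (hπ : IsInvariantProb Q π)
    (x : Fin d → ℝ) (i j : Fin d) : 0 ≤ π i * Q i j * (x i - x j) ^ 2 := by
  rcases eq_or_ne i j with rfl | hij
  · simp
  · exact mul_nonneg (mul_nonneg (hπ.nonneg i) (hQ.off_diag_nonneg _ _ hij)) (sq_nonneg _)

lemma sum_mul_generator_nonpos (hQ : IsRateMatrix Q) (hπ : IsInvariantProb Q π)
    (x : Fin d → ℝ) : ∑ i, π i * (x i * ∑ j, Q i j * x j) ≤ 0 := by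
  have h1 := two_mul_sum_mul_eq_neg_dirichlet hQ hπ x
  have h2 : 0 ≤ ∑ i, ∑ j, π i * Q i j * (x i - x j) ^ 2 :=
    Finset.sum_nonneg fun i _ => Finset.sum_nonneg fun j _ => dirichlet_term_nonneg hQ hπ x i j
  linarith

/-- A vanishing Dirichlet form makes x constant along every jump of positive rate, hence constant by
irreducibility, and its mean is zero. -/
lemma eq_zero_of_sum_mul_generator_eq_zero (hQ : IsRateMatrix Q) (hirr : IsIrreducibleRate Q)
    (hπ : IsInvariantProb Q π) {x : Fin d → ℝ} (hx : ∑ i, π i * x i = 0)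
    (h0 : ∑ i, π i * (x i * ∑ j, Q i j * x j) = 0) : x = 0 := by
  have h1 := two_mul_sum_mul_eq_neg_dirichlet hQ hπ x
  rw [h0, mul_zero, zero_eq_neg] at h1
  have h2 : ∀ i j, π i * Q i j * (x i - x j) ^ 2 = 0 := fun i j =>
    (Finset.sum_eq_zero_iff_of_nonneg fun j _ => dirichlet_term_nonneg hQ hπ x i j).1
      ((Finset.sum_eq_zero_iff_of_nonneg fun i _ => Finset.sum_nonneg fun j _ =>
        dirichlet_term_nonneg hQ hπ x i j).1 h1 i (Finset.mem_univ i)) j (Finset.mem_univ j)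
  have h3 : ∀ i j, x i = x j := by
    intro i j
    induction hirr i j with
    | refl => rfl
    | tail _ hab ih =>
      have h4 := (mul_eq_zero.1 (h2 _ _)).resolve_left (mul_pos (hπ.pos hQ hirr _) hab).ne'
      rw [ih, ← sub_eq_zero]
      exact pow_eq_zero_iff (two_ne_zero) |>.1 h4
  ext i
  have h4 : ∑ j, π j * x j = x i := by
    rw [Finset.sum_congr rfl fun j _ => by rw [h3 j i], ← Finset.sum_mul, hπ.sum_eq_one, one_mul]
  rw [← h4, hx, Pi.zero_apply]

/-- The Poincaré inequality for an irreducible finite chain. -/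
theorem exists_hasSpectralGap (hQ : IsRateMatrix Q) (hirr : IsIrreducibleRate Q)
    (hπ : IsInvariantProb Q π) : ∃ γ, HasSpectralGap π Q γ := by
  set E : (Fin d → ℝ) → ℝ := fun x => ∑ i, π i * (x i * ∑ j, Q i j * x j) with hE
  suffices h : ∃ γ > 0, ∀ x : Fin d → ℝ, ∑ i, π i * x i = 0 →
      E x ≤ -γ * ∑ i, π i * x i ^ 2 by
    obtain ⟨γ, hγ, hgap⟩ := h
    exact ⟨γ, hπ.pos hQ hirr, hπ.sum_eq_one, hγ, hQ.row_sum, fun j => congrFun hπ.invariant j,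
      sum_mul_generator_nonpos hQ hπ, hgap⟩
  have hEc : Continuous E := by fun_prop
  -- By homogeneity it suffices to bound the form on this compact set, where it is strictly
  -- negative. If there is no nonzero mean-zero vector the set is empty and any γ serves.
  set S : Set (Fin d → ℝ) := Metric.sphere 0 1 ∩ {x | ∑ i, π i * x i = 0} with hS
  have hScomp : IsCompact S :=
    (isCompact_sphere 0 1).inter_right (isClosed_eq (by fun_prop) continuous_const)
  have hneg : ∃ γ > 0, ∀ x ∈ S, E x ≤ -γ := by
    rcases S.eq_empty_or_nonempty with hemp | hne
    · exact ⟨1, one_pos, fun x hx => by simp [hemp] at hx⟩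
    · obtain ⟨x₀, hx₀, hmax⟩ := hScomp.exists_isMaxOn hne hEc.continuousOn
      refine ⟨-E x₀, ?_, fun x hx => by simpa using hmax hx⟩
      have h1 := sum_mul_generator_nonpos hQ hπ x₀
      rcases h1.lt_or_eq with h | h
      · simpa using h
      · have h0 := eq_zero_of_sum_mul_generator_eq_zero hQ hirr hπ hx₀.2 h
        have := hx₀.1
        simp [h0] at this
  obtain ⟨γ, hγ, hγS⟩ := hneg
  refine ⟨γ, hγ, fun x hx => ?_⟩
  rcases eq_or_ne x 0 with rfl | hx0
  · simp [hE]
  have hn : 0 < ‖x‖ := norm_pos_iff.2 hx0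
  have hmem : ‖x‖⁻¹ • x ∈ S := by
    refine ⟨by simp [norm_smul, hn.ne'], ?_⟩
    have : ∑ i, π i * (‖x‖⁻¹ • x) i = ‖x‖⁻¹ * ∑ i, π i * x i := by
      rw [Finset.mul_sum]
      exact Finset.sum_congr rfl fun i _ => by rw [Pi.smul_apply, smul_eq_mul]; ring
    rw [Set.mem_ofPred_eq, this, hx, mul_zero]
  have h1 := hγS _ hmem
  have h2 : E (‖x‖⁻¹ • x) = ‖x‖⁻¹ ^ 2 * E x := by
    simp only [hE, Finset.mul_sum]
    exact Finset.sum_congr rfl fun i _ => Finset.sum_congr rfl fun j _ => by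
      simp only [Pi.smul_apply, smul_eq_mul]; ring
  have h3 : E x ≤ -γ * ‖x‖ ^ 2 := by
    rw [h2, inv_pow, inv_mul_le_iff₀ (by positivity)] at h1
    linarith
  have h4 : ∑ i, π i * x i ^ 2 ≤ ‖x‖ ^ 2 := by
    calc ∑ i, π i * x i ^ 2 ≤ ∑ i, π i * ‖x‖ ^ 2 := by
          refine Finset.sum_le_sum fun i _ => mul_le_mul_of_nonneg_left ?_ (hπ.nonneg i)
          rw [← sq_abs]
          exact pow_le_pow_left₀ (abs_nonneg _) (norm_le_pi_norm x i) 2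
      _ = ‖x‖ ^ 2 := by rw [← Finset.sum_mul, hπ.sum_eq_one, one_mul]
  nlinarith

end Poincare

/-- The generator of the time-reversed chain. -/
def reversedRates {d : ℕ} (π : Fin d → ℝ) (Q : Matrix (Fin d) (Fin d) ℝ) : Matrix (Fin d) (Fin d) ℝ :=
  fun i j => π j * Q j i / π i

lemma HasSpectralGap.mul_reversal {d : ℕ} {Q : Matrix (Fin d) (Fin d) ℝ} {π : Fin d → ℝ} {γ : ℝ}
    (h : HasSpectralGap π Q γ) (i j : Fin d) : π i * reversedRates π Q i j = π j * Q j i := by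
  have := (h.pos i).ne'
  simp only [reversedRates]; field_simp

lemma HasSpectralGap.sum_reversal_mul {d : ℕ} {Q : Matrix (Fin d) (Fin d) ℝ} {π : Fin d → ℝ}
    {γ : ℝ} (h : HasSpectralGap π Q γ) (x y : Fin d → ℝ) :
    ∑ i, π i * (x i * ∑ j, Q i j * y j) = ∑ i, π i * (y i * ∑ j, reversedRates π Q i j * x j) := by
  have h1 : ∀ i, π i * (y i * ∑ j, reversedRates π Q i j * x j)
      = ∑ j, π j * Q j i * (x j * y i) := fun i => by
    simp only [Finset.mul_sum]
    refine Finset.sum_congr rfl fun j _ => ?_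
    rw [← h.mul_reversal i j]; ring
  simp only [h1]
  rw [Finset.sum_comm]
  simp only [Finset.mul_sum]
  exact Finset.sum_congr rfl fun i _ => Finset.sum_congr rfl fun j _ => by ring

/-- Moments evolve by the transpose of the generator, which relative to π is the reversed one, its
adjoint in ℓ²(π). Adjoints share the quadratic form and hence the gap. -/
lemma HasSpectralGap.reversal {d : ℕ} {Q : Matrix (Fin d) (Fin d) ℝ} {π : Fin d → ℝ} {γ : ℝ}
    (h : HasSpectralGap π Q γ) : HasSpectralGap π (reversedRates π Q) γ where
  pos := h.pos
  sum_eq_one := h.sum_eq_one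
  gap_pos := h.gap_pos
  row_sum i := by
    have : π i * ∑ j, reversedRates π Q i j = 0 := by
      rw [Finset.mul_sum, ← h.col_sum i]
      exact Finset.sum_congr rfl fun j _ => h.mul_reversal i j
    exact (mul_eq_zero.1 this).resolve_left (h.pos i).ne'
  col_sum j := by
    rw [Finset.sum_congr rfl fun i _ => h.mul_reversal i j, ← Finset.mul_sum, h.row_sum, mul_zero]
  dissipative x := by rw [← h.sum_reversal_mul]; exact h.dissipative x
  gap x hx := by rw [← h.sum_reversal_mul]; exact h.gap x hx

/-- Gronwall's inequality in the form of exponential relaxation towards the level `m`. -/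
lemma sub_le_exp_mul_of_deriv_le {q q' : ℝ → ℝ} {κ m T : ℝ} (hq : ∀ s, HasDerivAt q (q' s) s)
    (hle : ∀ s ∈ Set.Icc 0 T, q' s ≤ -κ * (q s - m)) {t : ℝ} (ht : t ∈ Set.Icc 0 T) :
    q t - m ≤ Real.exp (-κ * t) * (q 0 - m) := by
  have hd : ∀ s, HasDerivAt (fun s => Real.exp (κ * s) * (q s - m))
      (Real.exp (κ * s) * (κ * (q s - m) + q' s)) s := by
    intro s
    have h1 : HasDerivAt (fun s : ℝ => Real.exp (κ * s)) (Real.exp (κ * s) * κ) s := by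
      simpa using ((hasDerivAt_id s).const_mul κ).exp
    exact (h1.mul ((hq s).sub_const m)).congr_deriv (by ring)
  have hanti : AntitoneOn (fun s => Real.exp (κ * s) * (q s - m)) (Set.Icc 0 T) := by
    refine antitoneOn_of_deriv_nonpos (convex_Icc 0 T)
      (fun s _ => (hd s).continuousAt.continuousWithinAt)
      (fun s _ => (hd s).differentiableAt.differentiableWithinAt) fun s hs => ?_
    rw [(hd s).deriv]
    have := hle s (interior_subset hs)
    exact mul_nonpos_of_nonneg_of_nonpos (Real.exp_pos _).le (by linarith)
  have h := hanti ⟨le_rfl, ht.1.trans ht.2⟩ ht ht.1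
  simp only [mul_zero, Real.exp_zero, one_mul] at h
  have h2 : q t - m = Real.exp (-κ * t) * (Real.exp (κ * t) * (q t - m)) := by
    rw [← mul_assoc, ← Real.exp_add, neg_mul, neg_add_cancel, Real.exp_zero, one_mul]
  rw [h2]
  exact mul_le_mul_of_nonneg_left h (Real.exp_pos _).le

/-! ### Energy estimates -/

section Energy

variable {d : ℕ} {A : Matrix (Fin d) (Fin d) ℝ} {π : Fin d → ℝ} {γ : ℝ}

lemma hasDerivAt_energy {y y' : ℝ → Fin d → ℝ}
    (hy : ∀ s i, HasDerivAt (fun s => y s i) (y' s i) s) (s : ℝ) :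
    HasDerivAt (fun s => ∑ i, π i * y s i ^ 2) (2 * ∑ i, π i * (y s i * y' s i)) s := by
  have h := HasDerivAt.fun_sum fun i (_ : i ∈ Finset.univ) => ((hy s i).pow 2).const_mul (π i)
  refine h.congr_deriv ?_
  rw [Finset.mul_sum]
  exact Finset.sum_congr rfl fun i _ => by push_cast; ring

/-- Relaxation of the mean-zero part under fast switching. -/
lemma HasSpectralGap.energy_le (h : HasSpectralGap π A γ) {K G T : ℝ} (hK : 0 < K)
    {y g : ℝ → Fin d → ℝ}
    (hy : ∀ s i, HasDerivAt (fun s => y s i) (K * ∑ j, A i j * y s j + g s i) s)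
    (hmean : ∀ s, ∑ i, π i * y s i = 0)
    (hg : ∀ s ∈ Set.Icc 0 T, ∑ i, π i * g s i ^ 2 ≤ G) {t : ℝ} (ht : t ∈ Set.Icc 0 T) :
    ∑ i, π i * y t i ^ 2 - G / (K * γ) ^ 2
      ≤ Real.exp (-(K * γ) * t) * (∑ i, π i * y 0 i ^ 2 - G / (K * γ) ^ 2) := by
  have hc : 0 < K * γ := mul_pos hK h.gap_pos
  have hK0 := hK.ne'
  have hγ0 := h.gap_pos.ne'
  refine sub_le_exp_mul_of_deriv_le (hasDerivAt_energy hy) (fun s hs => ?_) ht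
  have h1 : ∑ i, π i * (y s i * (K * ∑ j, A i j * y s j + g s i))
      = K * ∑ i, π i * (y s i * ∑ j, A i j * y s j) + ∑ i, π i * (y s i * g s i) := by
    rw [Finset.mul_sum, ← Finset.sum_add_distrib]
    exact Finset.sum_congr rfl fun i _ => by ring
  have h2 := mul_le_mul_of_nonneg_left (h.gap (y s) (hmean s)) hK.le
  -- Young's inequality with weight Kγ uses up half of the dissipation 2Kγ; the other half gives the
  -- decay rate.
  have h3 : 2 * ∑ i, π i * (y s i * g s i)
      ≤ K * γ * ∑ i, π i * y s i ^ 2 + (K * γ)⁻¹ * ∑ i, π i * g s i ^ 2 := by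
    simp only [Finset.mul_sum, ← Finset.sum_add_distrib]
    refine Finset.sum_le_sum fun i _ => ?_
    have h4 : 0 ≤ π i * ((K * γ)⁻¹ * (K * γ * y s i - g s i) ^ 2) :=
      mul_nonneg (h.pos i).le (mul_nonneg (inv_pos.2 hc).le (sq_nonneg _))
    have h5 : π i * ((K * γ)⁻¹ * (K * γ * y s i - g s i) ^ 2)
        = K * γ * (π i * y s i ^ 2) + (K * γ)⁻¹ * (π i * g s i ^ 2)
          - 2 * (π i * (y s i * g s i)) := by
      field_simp
      ring
    linarith
  have h6 := mul_le_mul_of_nonneg_left (hg s hs) (inv_pos.2 hc).le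
  have h7 : -(K * γ) * (∑ i, π i * y s i ^ 2 - G / (K * γ) ^ 2)
      = -(K * γ) * ∑ i, π i * y s i ^ 2 + (K * γ)⁻¹ * G := by
    field_simp
    ring
  rw [h7, h1]
  linarith

/-- Bounds that do not depend on the speed of switching. -/
lemma HasSpectralGap.energy_le_exp (h : HasSpectralGap π A γ) {K G T : ℝ} (hK : 0 < K)
    {y g : ℝ → Fin d → ℝ} {c : Fin d → ℝ} (hc : ∀ i, 0 ≤ c i)
    (hy : ∀ s i, HasDerivAt (fun s => y s i) (K * ∑ j, A i j * y s j - c i * y s i + g s i) s)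
    (hg : ∀ s ∈ Set.Icc 0 T, ∑ i, π i * g s i ^ 2 ≤ G) {t : ℝ} (ht : t ∈ Set.Icc 0 T) :
    ∑ i, π i * y t i ^ 2 + G ≤ Real.exp t * (∑ i, π i * y 0 i ^ 2 + G) := by
  have key := sub_le_exp_mul_of_deriv_le (κ := -1) (m := -G) (T := T) (hasDerivAt_energy hy (π := π))
    (fun s hs => ?_) ht
  · simpa using key
  have h1 : 2 * ∑ i, π i * (y s i * (K * ∑ j, A i j * y s j - c i * y s i + g s i))
      = 2 * (K * ∑ i, π i * (y s i * ∑ j, A i j * y s j))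
        + ∑ i, π i * (2 * (y s i * g s i) - 2 * (c i * y s i ^ 2)) := by
    simp only [Finset.mul_sum, ← Finset.sum_add_distrib]
    exact Finset.sum_congr rfl fun i _ => by simp only [← Finset.mul_sum]; ring
  have h2 := mul_nonpos_of_nonneg_of_nonpos hK.le (h.dissipative (y s))
  have h3 : ∑ i, π i * (2 * (y s i * g s i) - 2 * (c i * y s i ^ 2))
      ≤ ∑ i, π i * y s i ^ 2 + ∑ i, π i * g s i ^ 2 := by
    rw [← Finset.sum_add_distrib]
    refine Finset.sum_le_sum fun i _ => ?_
    rw [← mul_add]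
    refine mul_le_mul_of_nonneg_left ?_ (h.pos i).le
    have := mul_nonneg (hc i) (sq_nonneg (y s i))
    nlinarith [sq_nonneg (y s i - g s i)]
  have := hg s hs
  rw [h1]
  linarith

end Energy

/-! ### Exponential ergodicity and the deviation matrix -/

section Deviation

variable {d : ℕ} {Q : Matrix (Fin d) (Fin d) ℝ} {π : Fin d → ℝ} {γ : ℝ}

lemma hasDerivAt_transProb_sub (hsum : ∀ i, ∑ j, Q i j = 0) (s : ℝ) (i j : Fin d) :
    HasDerivAt (fun s => transProb Q s i j - π j)
      (∑ k, Q i k * (transProb Q s k j - π j)) s := by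
  have h := (hasDerivAt_exp_smul_apply Q s i j).sub_const (π j)
  rw [exp_smul_mul_comm, Matrix.mul_apply] at h
  refine h.congr_deriv ?_
  simp only [mul_sub, Finset.sum_sub_distrib, ← Finset.sum_mul, hsum, zero_mul, sub_zero]
  rfl

/-- Invariance conserves this mean, which is zero at time 0. This is what lets the gap act on the
columns of p(t) - π. -/
lemma HasSpectralGap.sum_mul_transProb_sub (h : HasSpectralGap π Q γ) (s : ℝ) (j : Fin d) :
    ∑ i, π i * (transProb Q s i j - π j) = 0 := by
  have hd : ∀ s, HasDerivAt (fun s => ∑ i, π i * (transProb Q s i j - π j)) 0 s := by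
    intro s
    have h1 := HasDerivAt.fun_sum fun i (_ : i ∈ Finset.univ) =>
      (hasDerivAt_transProb_sub (π := π) h.row_sum s i j).const_mul (π i)
    refine h1.congr_deriv ?_
    simp only [Finset.mul_sum]
    rw [Finset.sum_comm]
    refine Finset.sum_eq_zero fun k _ => ?_
    simp only [← mul_assoc]
    rw [← Finset.sum_mul, h.col_sum, zero_mul]
  have h2 := is_const_of_deriv_eq_zero (fun s => (hd s).differentiableAt) (fun s => (hd s).deriv) s 0
  rw [h2]
  simp [transProb, mul_sub, Finset.sum_sub_distrib, ← Finset.sum_mul, h.sum_eq_one,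
    Matrix.one_apply]

/-- Exponential ergodicity. -/
lemma HasSpectralGap.abs_transProb_sub_le (h : HasSpectralGap π Q γ) (i j : Fin d) :
    ∃ C, ∀ t, 0 ≤ t → |transProb Q t i j - π j| ≤ C * Real.exp (-(γ / 2) * t) := by
  set q : ℝ → ℝ := fun t => ∑ i, π i * (transProb Q t i j - π j) ^ 2 with hq
  refine ⟨√(q 0 / π i), fun t ht => ?_⟩
  -- Unit speed and no source: the energy decays at rate γ, hence the entries at rate γ/2.
  have h1 := h.energy_le (T := t) (K := 1) (G := 0) (g := fun _ _ => 0) one_pos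
    (y := fun t i => transProb Q t i j - π j)
    (fun s i => by simpa using hasDerivAt_transProb_sub h.row_sum s i j)
    (fun s => h.sum_mul_transProb_sub s j) (by simp) ⟨ht, le_rfl⟩
  simp only [zero_div, sub_zero, one_mul] at h1
  have h2 : π i * (transProb Q t i j - π j) ^ 2 ≤ q t :=
    Finset.single_le_sum (f := fun i => π i * (transProb Q t i j - π j) ^ 2)
      (fun k _ => mul_nonneg (h.pos k).le (sq_nonneg _)) (Finset.mem_univ i)
  refine abs_le_of_sq_le_sq ?_ (by positivity)
  have h3 : Real.exp (-γ * t) = Real.exp (-(γ / 2) * t) ^ 2 := by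
    rw [← Real.exp_nat_mul]; congr 1; push_cast; ring
  have h4 : 0 ≤ q 0 := Finset.sum_nonneg fun k _ => mul_nonneg (h.pos k).le (sq_nonneg _)
  rw [mul_pow, Real.sq_sqrt (div_nonneg h4 (h.pos i).le), ← h3, div_mul_eq_mul_div,
    le_div_iff₀ (h.pos i)]
  calc _ = π i * (transProb Q t i j - π j) ^ 2 := mul_comm _ _
    _ ≤ _ := h2.trans h1
    _ = _ := mul_comm _ _

lemma continuous_transProb_sub (hsum : ∀ i, ∑ j, Q i j = 0) (i j : Fin d) :
    Continuous fun t => transProb Q t i j - π j :=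
  continuous_iff_continuousAt.2 fun s => (hasDerivAt_transProb_sub hsum s i j).continuousAt

lemma HasSpectralGap.integrableOn_transProb_sub (h : HasSpectralGap π Q γ) (i j : Fin d) :
    IntegrableOn (fun t => transProb Q t i j - π j) (Set.Ioi 0) := by
  obtain ⟨C, hC⟩ := h.abs_transProb_sub_le i j
  have h1 : IntegrableOn (fun t : ℝ => C * Real.exp (-(γ / 2) * t)) (Set.Ioi 0) :=
    (exp_neg_integrableOn_Ioi 0 (half_pos h.gap_pos)).const_mul C
  refine Integrable.mono' h1
    (continuous_transProb_sub h.row_sum i j).aestronglyMeasurable ?_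
  filter_upwards [ae_restrict_mem measurableSet_Ioi] with t ht using hC t (le_of_lt ht)

lemma HasSpectralGap.tendsto_transProb_sub (h : HasSpectralGap π Q γ) (i j : Fin d) :
    Tendsto (fun t => transProb Q t i j - π j) atTop (𝓝 0) := by
  obtain ⟨C, hC⟩ := h.abs_transProb_sub_le i j
  have h1 : Tendsto (fun t : ℝ => C * Real.exp (-(γ / 2) * t)) atTop (𝓝 0) := by
    have h2 : Tendsto (fun t : ℝ => γ / 2 * t) atTop atTop :=
      tendsto_id.const_mul_atTop (half_pos h.gap_pos)
    have h3 := (Real.tendsto_exp_neg_atTop_nhds_zero.comp h2).const_mul C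
    simpa [Function.comp_def, neg_mul] using h3
  refine squeeze_zero_norm' ?_ h1
  filter_upwards [eventually_ge_atTop 0] with t ht using hC t ht

/-- Integrate the derivative of p(t) - π over the half-line: it vanishes at infinity and equals the
identity minus π at time 0. -/
lemma HasSpectralGap.sum_mul_deviationMatrix (h : HasSpectralGap π Q γ) (i j : Fin d) :
    ∑ k, Q i k * deviationMatrix Q π k j = π j - if i = j then 1 else 0 := by
  have hint := fun k => (h.integrableOn_transProb_sub k j).const_mul (Q i k)
  have h1 := integral_Ioi_of_hasDerivAt_of_tendsto' (a := 0)
    (fun t _ => hasDerivAt_transProb_sub (π := π) h.row_sum t i j)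
    (integrable_finsetSum _ fun k _ => hint k) (h.tendsto_transProb_sub i j)
  rw [integral_finsetSum _ fun k _ => hint k] at h1
  simp only [integral_const_mul] at h1
  simp only [deviationMatrix, Matrix.of_apply]
  rw [h1]
  simp [transProb, Matrix.one_apply]

lemma HasSpectralGap.sum_mul_deviationMatrix_eq_zero (h : HasSpectralGap π Q γ) (j : Fin d) :
    ∑ i, π i * deviationMatrix Q π i j = 0 := by
  simp only [deviationMatrix, Matrix.of_apply, ← integral_const_mul]
  rw [← integral_finsetSum _ fun k _ => (h.integrableOn_transProb_sub k j).const_mul (π k)]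
  simp [h.sum_mul_transProb_sub]

/-- The deviation matrix solves the Poisson equation. -/
lemma HasSpectralGap.sum_mul_deviationMatrix_mulVec (h : HasSpectralGap π Q γ) (x : Fin d → ℝ)
    (i : Fin d) : ∑ k, Q i k * (deviationMatrix Q π *ᵥ x) k = ∑ j, π j * x j - x i := by
  have h1 : ∑ k, Q i k * (deviationMatrix Q π *ᵥ x) k
      = ∑ j, (∑ k, Q i k * deviationMatrix Q π k j) * x j := by
    simp only [Matrix.mulVec, dotProduct, Finset.mul_sum, Finset.sum_mul]
    rw [Finset.sum_comm]
    exact Finset.sum_congr rfl fun j _ => Finset.sum_congr rfl fun k _ => by ring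
  simp [h1, h.sum_mul_deviationMatrix, sub_mul, Finset.sum_sub_distrib]

lemma HasSpectralGap.sum_mul_deviationMatrix_mulVec_eq_zero (h : HasSpectralGap π Q γ)
    (x : Fin d → ℝ) : ∑ k, π k * (deviationMatrix Q π *ᵥ x) k = 0 := by
  have h1 : ∑ k, π k * (deviationMatrix Q π *ᵥ x) k
      = ∑ j, (∑ k, π k * deviationMatrix Q π k j) * x j := by
    simp only [Matrix.mulVec, dotProduct, Finset.mul_sum, Finset.sum_mul]
    rw [Finset.sum_comm]
    exact Finset.sum_congr rfl fun j _ => Finset.sum_congr rfl fun k _ => by ring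
  simp [h1, h.sum_mul_deviationMatrix_eq_zero]

end Deviation

/-! ### Bounds uniform in the scaling parameter -/

section UnifBdd

/-- The functions `f N`, `N ≥ 1`, are bounded on `[0, T]` uniformly in `N`. -/
def UnifBdd {E : Type*} [Norm E] (T : ℝ) (f : ℝ → ℝ → E) : Prop :=
  ∃ C, ∀ N, 1 ≤ N → ∀ s ∈ Set.Icc 0 T, ‖f N s‖ ≤ C

variable {E : Type*} {T : ℝ}

lemma UnifBdd.congr [Norm E] {f g : ℝ → ℝ → E} (hf : UnifBdd T f)
    (h : ∀ N s, g N s = f N s) : UnifBdd T g := by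
  obtain ⟨C, hC⟩ := hf
  exact ⟨C, fun N hN s hs => by rw [h]; exact hC N hN s hs⟩

lemma UnifBdd.add [SeminormedAddGroup E] {f g : ℝ → ℝ → E} (hf : UnifBdd T f)
    (hg : UnifBdd T g) : UnifBdd T (fun N s => f N s + g N s) := by
  obtain ⟨C, hC⟩ := hf
  obtain ⟨D, hD⟩ := hg
  exact ⟨C + D, fun N hN s hs => norm_add_le_of_le (hC N hN s hs) (hD N hN s hs)⟩

lemma UnifBdd.sub [SeminormedAddGroup E] {f g : ℝ → ℝ → E} (hf : UnifBdd T f)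
    (hg : UnifBdd T g) : UnifBdd T (fun N s => f N s - g N s) := by
  obtain ⟨C, hC⟩ := hf
  obtain ⟨D, hD⟩ := hg
  exact ⟨C + D, fun N hN s hs => norm_sub_le_of_le (hC N hN s hs) (hD N hN s hs)⟩

lemma UnifBdd.mul [NonUnitalSeminormedRing E] {f g : ℝ → ℝ → E} (hf : UnifBdd T f)
    (hg : UnifBdd T g) : UnifBdd T (fun N s => f N s * g N s) := by
  obtain ⟨C, hC⟩ := hf
  obtain ⟨D, hD⟩ := hg
  exact ⟨C * D, fun N hN s hs => norm_mul_le_of_le (hC N hN s hs) (hD N hN s hs)⟩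

lemma UnifBdd.smul [SeminormedAddCommGroup E] [NormedSpace ℝ E] {f : ℝ → ℝ → ℝ}
    {g : ℝ → ℝ → E} (hf : UnifBdd T f) (hg : UnifBdd T g) :
    UnifBdd T (fun N s => f N s • g N s) := by
  obtain ⟨C, hC⟩ := hf
  obtain ⟨D, hD⟩ := hg
  refine ⟨C * D, fun N hN s hs => ?_⟩
  rw [norm_smul]
  exact mul_le_mul (hC N hN s hs) (hD N hN s hs) (norm_nonneg _)
    ((norm_nonneg _).trans (hC N hN s hs))

lemma unifBdd_const [Norm E] (c : E) : UnifBdd T (fun _ _ => c) :=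
  ⟨‖c‖, fun _ _ _ _ => le_rfl⟩

lemma unifBdd_of_continuous [SeminormedAddGroup E] {f : ℝ → E} (hf : Continuous f) :
    UnifBdd T (fun _ s => f s) := by
  obtain ⟨C, hC⟩ := (isCompact_Icc (a := (0 : ℝ)) (b := T)).exists_bound_of_continuousOn
    hf.continuousOn
  exact ⟨C, fun _ _ s hs => hC s hs⟩

lemma UnifBdd.map [SeminormedAddCommGroup E] [NormedSpace ℝ E] {f : ℝ → ℝ → E}
    (hf : UnifBdd T f) (L : E →L[ℝ] ℝ) : UnifBdd T (fun N s => L (f N s)) := by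
  obtain ⟨C, hC⟩ := hf
  exact ⟨‖L‖ * C, fun N hN s hs => L.le_opNorm_of_le (hC N hN s hs)⟩

/-- Since κ ≥ 0, (y²)' ≤ y² + g², and Gronwall gives y² ≤ e^T G². The added 1 in the bound passes
from y² to |y| without a square root. -/
lemma unifBdd_of_hasDerivAt {κ : ℝ} (hκ : 0 ≤ κ) {y g : ℝ → ℝ → ℝ}
    (hy : ∀ N, 1 ≤ N → ∀ s, HasDerivAt (y N) (-κ * y N s + g N s) s)
    (h0 : ∀ N, 1 ≤ N → y N 0 = 0) (hg : UnifBdd T g) : UnifBdd T y := by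
  obtain ⟨G, hG⟩ := hg
  refine ⟨Real.exp T * G ^ 2 + 1, fun N hN t ht => ?_⟩
  have key := sub_le_exp_mul_of_deriv_le (κ := -1) (m := -G ^ 2) (T := T)
    (fun s => (hy N hN s).pow 2) (fun s hs => ?_) ht
  · simp only [Pi.pow_apply, h0 N hN] at key
    have h1 : Real.exp t ≤ Real.exp T := Real.exp_le_exp.2 ht.2
    have h2 := mul_le_mul_of_nonneg_right h1 (sq_nonneg G)
    rw [Real.norm_eq_abs]
    have h3 : y N t ^ 2 + G ^ 2 ≤ Real.exp t * G ^ 2 := by simpa using key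
    nlinarith [sq_nonneg (|y N t| - 1), sq_abs (y N t), sq_nonneg G, abs_nonneg (y N t)]
  · have h1 : g N s ^ 2 ≤ G ^ 2 := by
      rw [← sq_abs]
      exact pow_le_pow_left₀ (abs_nonneg _) (hG N hN s hs) 2
    have h2 := mul_nonneg hκ (sq_nonneg (y N s))
    simp only [Pi.pow_apply]
    push_cast
    nlinarith [sq_nonneg (y N s - g N s)]

end UnifBdd

/-! ### Averages and fluctuations -/

section Average

variable {d : ℕ} {A Q : Matrix (Fin d) (Fin d) ℝ} {π : Fin d → ℝ} {γ : ℝ}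

/-- Averaging with respect to `π`. -/
def av (π : Fin d → ℝ) : (Fin d → ℝ) →L[ℝ] ℝ := ∑ i, π i • ContinuousLinearMap.proj i

lemma av_apply (π x : Fin d → ℝ) : av π x = ∑ i, π i * x i := by
  simp [av]

/-- The fluctuation of a function around its average. -/
def fluct (π x : Fin d → ℝ) : Fin d → ℝ := x - fun _ => av π x

lemma fluct_apply (π x : Fin d → ℝ) (i : Fin d) : fluct π x i = x i - av π x := rfl

lemma HasSpectralGap.av_const (h : HasSpectralGap π A γ) (c : ℝ) : av π (fun _ => c) = c := by
  rw [av_apply, ← Finset.sum_mul, h.sum_eq_one, one_mul]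

lemma HasSpectralGap.av_fluct (h : HasSpectralGap π A γ) (x : Fin d → ℝ) :
    av π (fluct π x) = 0 := by
  rw [fluct, map_sub, h.av_const, sub_self]

lemma HasSpectralGap.av_mulVec (h : HasSpectralGap π A γ) (x : Fin d → ℝ) :
    av π (A *ᵥ x) = 0 := by
  simp only [av_apply, Matrix.mulVec, dotProduct, Finset.mul_sum]
  rw [Finset.sum_comm]
  refine Finset.sum_eq_zero fun j _ => ?_
  simp only [← mul_assoc]
  rw [← Finset.sum_mul, h.col_sum, zero_mul]

lemma HasSpectralGap.mulVec_fluct (h : HasSpectralGap π A γ) (x : Fin d → ℝ) :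
    A *ᵥ fluct π x = A *ᵥ x := by
  ext i
  simp only [Matrix.mulVec, dotProduct, fluct_apply, mul_sub, Finset.sum_sub_distrib,
    ← Finset.sum_mul, h.row_sum, zero_mul, sub_zero]

lemma HasSpectralGap.av_mul_eq (h : HasSpectralGap π A γ) (x y : Fin d → ℝ) :
    av π (x * y) = av π x * av π y + av π (fluct π x * fluct π y) := by
  have h1 : fluct π x * fluct π y = x * y - av π x • y - av π y • x
      + fun _ => av π x * av π y := by
    ext i
    simp only [Pi.mul_apply, Pi.add_apply, Pi.sub_apply, Pi.smul_apply, smul_eq_mul, fluct_apply]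
    ring
  rw [h1, map_add, map_sub, map_sub, map_smul, map_smul, h.av_const, smul_eq_mul, smul_eq_mul]
  ring

lemma HasSpectralGap.av_mul_of_av_eq_zero (h : HasSpectralGap π A γ) (x : Fin d → ℝ)
    {y : Fin d → ℝ} (hy : av π y = 0) : av π (x * y) = av π (fluct π x * y) := by
  rw [h.av_mul_eq, hy, mul_zero, zero_add]
  congr 2
  ext i
  rw [fluct_apply, hy, sub_zero]

/-- The Poisson equation in weak form, for the time-reversed chain. -/
lemma HasSpectralGap.av_reversal_mulVec_mul (h : HasSpectralGap π Q γ) (x y : Fin d → ℝ) :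
    av π ((reversedRates π Q *ᵥ x) * (deviationMatrix Q π *ᵥ y)) = av π x * av π y - av π (x * y) := by
  have h1 := h.sum_reversal_mul x (deviationMatrix Q π *ᵥ y)
  have h2 : av π ((reversedRates π Q *ᵥ x) * (deviationMatrix Q π *ᵥ y))
      = ∑ i, π i * ((deviationMatrix Q π *ᵥ y) i * ∑ j, reversedRates π Q i j * x j) := by
    rw [av_apply]
    exact Finset.sum_congr rfl fun i _ => by rw [Pi.mul_apply, mul_comm ((_ *ᵥ _) i)]; rfl
  rw [h2, ← h1]
  simp only [h.sum_mul_deviationMatrix_mulVec, ← av_apply]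
  simp only [av_apply, Finset.sum_mul, ← Finset.sum_sub_distrib, Pi.mul_apply]
  exact Finset.sum_congr rfl fun i _ => by ring

lemma HasSpectralGap.av_deviationMatrix_mulVec (h : HasSpectralGap π Q γ) (x : Fin d → ℝ) :
    av π (deviationMatrix Q π *ᵥ x) = 0 := by
  rw [av_apply]; exact h.sum_mul_deviationMatrix_mulVec_eq_zero x

lemma hasDerivAt_av_mul {y : ℝ → Fin d → ℝ} {y' : Fin d → ℝ} {s : ℝ} (hy : HasDerivAt y y' s)
    (x : Fin d → ℝ) : HasDerivAt (fun s => av π (y s * x)) (av π (y' * x)) s :=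
  (av π).hasFDerivAt.comp_hasDerivAt s (hy.mul_const x)

lemma hasDerivAt_av {y : ℝ → Fin d → ℝ} {y' : Fin d → ℝ} {s : ℝ} (hy : HasDerivAt y y' s) :
    HasDerivAt (fun s => av π (y s)) (av π y') s :=
  (av π).hasFDerivAt.comp_hasDerivAt s hy

lemma HasSpectralGap.energy_le_of_norm_le (h : HasSpectralGap π A γ) {x : Fin d → ℝ} {C : ℝ}
    (hx : ‖x‖ ≤ C) : ∑ i, π i * x i ^ 2 ≤ C ^ 2 := by
  calc ∑ i, π i * x i ^ 2 ≤ ∑ i, π i * C ^ 2 := by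
        refine Finset.sum_le_sum fun i _ => mul_le_mul_of_nonneg_left ?_ (h.pos i).le
        rw [← sq_abs]
        exact pow_le_pow_left₀ (abs_nonneg _) ((norm_le_pi_norm x i).trans hx) 2
    _ = C ^ 2 := by rw [← Finset.sum_mul, h.sum_eq_one, one_mul]

lemma HasSpectralGap.norm_le_of_energy_le (h : HasSpectralGap π A γ) {x : Fin d → ℝ} {C : ℝ}
    (hx : ∑ i, π i * x i ^ 2 ≤ C) : ‖x‖ ≤ 1 + ∑ i, C / π i := by
  have hC : 0 ≤ C := le_trans
    (Finset.sum_nonneg fun i _ => mul_nonneg (h.pos i).le (sq_nonneg (x i))) hx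
  have hnn : ∀ i ∈ Finset.univ, 0 ≤ C / π i := fun i _ => div_nonneg hC (h.pos i).le
  refine (pi_norm_le_iff_of_nonneg (add_nonneg zero_le_one (Finset.sum_nonneg hnn))).2 fun i => ?_
  have h1 : π i * x i ^ 2 ≤ C := (Finset.single_le_sum (f := fun i => π i * x i ^ 2)
    (fun j _ => mul_nonneg (h.pos j).le (sq_nonneg _)) (Finset.mem_univ i)).trans hx
  have h2 : x i ^ 2 ≤ C / π i := by rw [le_div_iff₀ (h.pos i)]; linarith
  have h3 := Finset.single_le_sum hnn (Finset.mem_univ i)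
  rw [Real.norm_eq_abs]
  nlinarith [sq_nonneg (|x i| - 1), sq_abs (x i)]

variable {T : ℝ} {K : ℝ → ℝ}

/-- Fluctuations under fast switching are of the order of the inverse speed. -/
lemma HasSpectralGap.unifBdd_smul_fluct (h : HasSpectralGap π A γ) (hK : ∀ N, 1 ≤ N → 1 ≤ K N)
    {y g : ℝ → ℝ → Fin d → ℝ}
    (hy : ∀ N, 1 ≤ N → ∀ s, HasDerivAt (y N) (K N • (A *ᵥ y N s) + g N s) s)
    (h0 : ∀ N, 1 ≤ N → fluct π (y N 0) = 0) (hg : UnifBdd T g) :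
    UnifBdd T (fun N s => K N • fluct π (y N s)) := by
  have hfg : ∃ G, ∀ N, 1 ≤ N → ∀ s ∈ Set.Icc 0 T, ‖fluct π (g N s)‖ ≤ G := by
    obtain ⟨C, hC⟩ := hg
    refine ⟨C + ‖av π‖ * C, fun N hN s hs => ?_⟩
    refine norm_sub_le_of_le (hC N hN s hs) ?_
    have h1 : ‖av π (g N s)‖ ≤ ‖av π‖ * C := (av π).le_opNorm_of_le (hC N hN s hs)
    exact (pi_norm_le_iff_of_nonneg ((norm_nonneg _).trans h1)).2 fun _ => h1
  obtain ⟨G, hG⟩ := hfg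
  refine ⟨1 + ∑ i, G ^ 2 / γ ^ 2 / π i, fun N hN t ht => ?_⟩
  have hK0 : 0 < K N := zero_lt_one.trans_le (hK N hN)
  have hγ := h.gap_pos
  refine h.norm_le_of_energy_le ?_
  have hd : ∀ s i, HasDerivAt (fun s => fluct π (y N s) i)
      (K N * ∑ j, A i j * fluct π (y N s) j + fluct π (g N s) i) s := by
    intro s i
    have h1 := (hasDerivAt_pi.1 (hy N hN s) i).sub (hasDerivAt_av (π := π) (hy N hN s))
    refine h1.congr_deriv ?_
    rw [map_add, map_smul, h.av_mulVec, smul_zero, zero_add, ← h.mulVec_fluct]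
    simp only [Pi.add_apply, Pi.smul_apply, smul_eq_mul, fluct_apply (x := g N s),
      Matrix.mulVec, dotProduct]
    ring
  have h2 := h.energy_le hK0 hd (fun s => by rw [← av_apply, h.av_fluct])
    (fun s hs => h.energy_le_of_norm_le (hG N hN s hs)) ht
  rw [h0 N hN] at h2
  have h3 : 0 ≤ G ^ 2 / (K N * γ) ^ 2 := by positivity
  -- The fluctuation starts at zero, so there is no initial layer and the bound holds from time 0
  -- on.
  have h4 : Real.exp (-(K N * γ) * t) * (∑ i, π i * (0 : Fin d → ℝ) i ^ 2
      - G ^ 2 / (K N * γ) ^ 2) ≤ 0 := by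
    refine mul_nonpos_of_nonneg_of_nonpos (Real.exp_pos _).le ?_
    simpa using h3
  have h5 : ∑ i, π i * fluct π (y N t) i ^ 2 ≤ G ^ 2 / (K N * γ) ^ 2 := by linarith
  have h6 : ∑ i, π i * (K N • fluct π (y N t)) i ^ 2
      = K N ^ 2 * ∑ i, π i * fluct π (y N t) i ^ 2 := by
    rw [Finset.mul_sum]
    exact Finset.sum_congr rfl fun i _ => by rw [Pi.smul_apply, smul_eq_mul]; ring
  rw [h6]
  calc _ ≤ K N ^ 2 * (G ^ 2 / (K N * γ) ^ 2) := mul_le_mul_of_nonneg_left h5 (sq_nonneg _)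
    _ = G ^ 2 / γ ^ 2 := by field_simp

/-- The fast term is dissipative and the damping has the right sign, so neither can increase the
energy, whatever the speed. -/
lemma HasSpectralGap.unifBdd_of_hasDerivAt (h : HasSpectralGap π A γ)
    (hK : ∀ N, 1 ≤ N → 1 ≤ K N) {c y₀ : Fin d → ℝ} (hc : ∀ i, 0 ≤ c i)
    {y g : ℝ → ℝ → Fin d → ℝ}
    (hy : ∀ N, 1 ≤ N → ∀ s, HasDerivAt (y N) (K N • (A *ᵥ y N s) + (g N s - c * y N s)) s)
    (h0 : ∀ N, 1 ≤ N → y N 0 = y₀) (hg : UnifBdd T g) : UnifBdd T y := by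
  obtain ⟨G, hG⟩ := hg
  refine ⟨1 + ∑ i, Real.exp T * (∑ i, π i * y₀ i ^ 2 + G ^ 2) / π i, fun N hN t ht => ?_⟩
  refine h.norm_le_of_energy_le ?_
  have h1 := h.energy_le_exp (zero_lt_one.trans_le (hK N hN)) hc (fun s i =>
    (hasDerivAt_pi.1 (hy N hN s) i).congr_deriv (g' := K N * ∑ j, A i j * y N s j
      - c i * y N s i + g N s i) (by
        simp only [Pi.add_apply, Pi.sub_apply, Pi.mul_apply, Pi.smul_apply, smul_eq_mul,
          Matrix.mulVec, dotProduct]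
        ring)) (fun s hs => h.energy_le_of_norm_le (hG N hN s hs)) ht
  rw [h0 N hN] at h1
  have h2 : 0 ≤ ∑ i, π i * y₀ i ^ 2 :=
    Finset.sum_nonneg fun i _ => mul_nonneg (h.pos i).le (sq_nonneg _)
  have h3 := mul_le_mul_of_nonneg_right (Real.exp_le_exp.2 ht.2) (add_nonneg h2 (sq_nonneg G))
  linarith [sq_nonneg G]

end Average

/-! ### Differential equations of the limit functions -/

section Limits

variable {d : ℕ} {Q : Matrix (Fin d) (Fin d) ℝ} {π lam mu : Fin d → ℝ} {γ : ℝ}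

lemma dotProduct_eq_av (π x : Fin d → ℝ) : π ⬝ᵥ x = av π x := (av_apply π x).symm

lemma rhoI_zero (lam mu π : Fin d → ℝ) : rhoI lam mu π 0 = 0 := by simp [rhoI]

lemma hasDerivAt_rhoI (hm : av π mu ≠ 0) (s : ℝ) :
    HasDerivAt (rhoI lam mu π) (av π lam - av π mu * rhoI lam mu π s) s := by
  have h1 : HasDerivAt (fun s : ℝ => Real.exp (-(av π mu) * s))
      (Real.exp (-(av π mu) * s) * -(av π mu)) s := by
    simpa using ((hasDerivAt_id s).const_mul (-(av π mu))).exp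
  have h2 := (h1.const_sub 1).const_mul (av π lam / av π mu)
  have h3 : rhoI lam mu π = fun s => av π lam / av π mu * (1 - Real.exp (-(av π mu) * s)) := by
    ext s; simp only [rhoI, dotProduct_eq_av]
  rw [h3]
  refine h2.congr_deriv ?_
  field_simp
  ring

lemma continuous_rhoI (lam mu π : Fin d → ℝ) : Continuous (rhoI lam mu π) := by
  unfold rhoI; fun_prop

/-- The source term in the differential equation for the limiting variance. -/
def varSource (lam mu : Fin d → ℝ) (Q : Matrix (Fin d) (Fin d) ℝ) (π : Fin d → ℝ) (s : ℝ) : ℝ :=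
  av π ((lam - rhoI lam mu π s • mu) * (deviationMatrix Q π *ᵥ (lam - rhoI lam mu π s • mu)))

lemma continuous_varSource (lam mu : Fin d → ℝ) (Q : Matrix (Fin d) (Fin d) ℝ) (π : Fin d → ℝ) :
    Continuous (varSource lam mu Q π) := by
  have h := continuous_rhoI lam mu π
  unfold varSource
  refine (av π).continuous.comp ?_
  have h2 : Continuous fun s => lam - rhoI lam mu π s • mu := by fun_prop
  exact h2.mul (Continuous.matrix_mulVec continuous_const h2)

lemma varSource_eq (lam mu : Fin d → ℝ) (Q : Matrix (Fin d) (Fin d) ℝ) (π : Fin d → ℝ) (s : ℝ) :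
    π ⬝ᵥ (((Matrix.diagonal lam - rhoI lam mu π s • Matrix.diagonal mu) * deviationMatrix Q π
      * (Matrix.diagonal lam - rhoI lam mu π s • Matrix.diagonal mu)) *ᵥ 1)
      = varSource lam mu Q π s := by
  have h1 : ∀ x : Fin d → ℝ,
      (Matrix.diagonal lam - rhoI lam mu π s • Matrix.diagonal mu) *ᵥ x
        = (lam - rhoI lam mu π s • mu) * x := by
    intro x
    ext i
    rw [Matrix.sub_mulVec, Matrix.smul_mulVec, Pi.sub_apply, Pi.smul_apply, Matrix.mulVec_diagonal,
      Matrix.mulVec_diagonal]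
    simp only [Pi.mul_apply, Pi.sub_apply, Pi.smul_apply, smul_eq_mul]
    ring
  rw [← Matrix.mulVec_mulVec, ← Matrix.mulVec_mulVec, h1, h1, mul_one, dotProduct_eq_av, varSource]

lemma sigmaI_zero (lam mu : Fin d → ℝ) (Q : Matrix (Fin d) (Fin d) ℝ) (π : Fin d → ℝ) :
    sigmaI lam mu Q π 0 = 0 := by simp [sigmaI]

lemma hasDerivAt_sigmaI (lam mu : Fin d → ℝ) (Q : Matrix (Fin d) (Fin d) ℝ) (π : Fin d → ℝ)
    (s : ℝ) : HasDerivAt (sigmaI lam mu Q π)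
      (-(2 * av π mu) * sigmaI lam mu Q π s + 2 * varSource lam mu Q π s) s := by
  set m := av π mu with hm
  have h1 : sigmaI lam mu Q π = fun t => 2 * (Real.exp (-(2 * m) * t)
      * ∫ s in (0 : ℝ)..t, Real.exp (2 * m * s) * varSource lam mu Q π s) := by
    ext t
    simp only [sigmaI, varSource_eq]
    rw [dotProduct_eq_av, ← hm, ← intervalIntegral.integral_const_mul (Real.exp _)]
    congr 1
    refine intervalIntegral.integral_congr fun s _ => ?_
    rw [← mul_assoc, ← Real.exp_add]
    congr 2; ring
  have hc : Continuous fun s => Real.exp (2 * m * s) * varSource lam mu Q π s :=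
    (by fun_prop : Continuous fun s : ℝ => Real.exp (2 * m * s)).mul
      (continuous_varSource lam mu Q π)
  have h2 := (hc.integral_hasStrictDerivAt 0 s).hasDerivAt
  have h3 : HasDerivAt (fun s : ℝ => Real.exp (-(2 * m) * s))
      (Real.exp (-(2 * m) * s) * -(2 * m)) s := by
    simpa using ((hasDerivAt_id s).const_mul (-(2 * m))).exp
  have h4 := (h3.mul h2).const_mul 2
  rw [h1]
  refine h4.congr_deriv ?_
  have h5 : Real.exp (-(2 * m) * s) * Real.exp (2 * m * s) = 1 := by
    rw [← Real.exp_add, neg_mul, neg_add_cancel, Real.exp_zero]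
  linear_combination 2 * varSource lam mu Q π s * h5

end Limits

/-! ### Moments under fast switching -/

/-- Scaled first and second factorial moments, relative to `π`, when the background process is
sped up by the factor `K`. -/
structure IsMomentSystem {d : ℕ} (π : Fin d → ℝ) (Q : Matrix (Fin d) (Fin d) ℝ)
    (lam mu : Fin d → ℝ) (K : ℝ) (h k : ℝ → Fin d → ℝ) : Prop where
  h_zero : h 0 = 0
  k_zero : k 0 = 0
  hasDerivAt_h : ∀ s, HasDerivAt h (K • (reversedRates π Q *ᵥ h s) + (lam - mu * h s)) s
  hasDerivAt_k : ∀ s, HasDerivAt k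
    (K • (reversedRates π Q *ᵥ k s) + ((2 : ℝ) • (lam * h s) - (2 : ℝ) • (mu * k s))) s

/-- Scaled coefficients of the conditional mean, when the background process is sped up by the
factor `K`. -/
structure IsMeanSystem {d : ℕ} (Q : Matrix (Fin d) (Fin d) ℝ)
    (lam mu : Fin d → ℝ) (K : ℝ) (b a : ℝ → Fin d → ℝ) : Prop where
  b_zero : b 0 = 1
  a_zero : a 0 = 0
  hasDerivAt_b : ∀ s, HasDerivAt b (K • (Q *ᵥ b s) + -(mu * b s)) s
  hasDerivAt_a : ∀ s, HasDerivAt a (K • (Q *ᵥ a s) + lam * b s) s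

section MomentSystem

variable {d : ℕ} {Q : Matrix (Fin d) (Fin d) ℝ} {π lam mu : Fin d → ℝ} {γ T : ℝ}

section Single

variable {K : ℝ} {h k : ℝ → Fin d → ℝ}

lemma IsMomentSystem.hasDerivAt_av_h (hs : IsMomentSystem π Q lam mu K h k)
    (hg : HasSpectralGap π Q γ) (s : ℝ) :
    HasDerivAt (fun s => av π (h s)) (av π lam - av π (mu * h s)) s := by
  refine (hasDerivAt_av (hs.hasDerivAt_h s)).congr_deriv ?_
  rw [map_add, map_smul, hg.reversal.av_mulVec, smul_zero, zero_add, map_sub]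

lemma IsMomentSystem.hasDerivAt_av_k (hs : IsMomentSystem π Q lam mu K h k)
    (hg : HasSpectralGap π Q γ) (s : ℝ) :
    HasDerivAt (fun s => av π (k s)) (2 * av π (lam * h s) - 2 * av π (mu * k s)) s := by
  refine (hasDerivAt_av (hs.hasDerivAt_k s)).congr_deriv ?_
  rw [map_add, map_smul, hg.reversal.av_mulVec, smul_zero, zero_add, map_sub, map_smul, map_smul]
  rfl

/-- Testing against the Poisson solution D x turns the fast term into -K times the π-covariance of h
and x. This is the mechanism by which the corrector removes such covariances elsewhere. -/
lemma IsMomentSystem.hasDerivAt_av_h_mul (hs : IsMomentSystem π Q lam mu K h k)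
    (hg : HasSpectralGap π Q γ) (x : Fin d → ℝ) (s : ℝ) :
    HasDerivAt (fun s => av π (h s * (deviationMatrix Q π *ᵥ x)))
      (K * (av π (h s) * av π x - av π (h s * x))
        + av π ((lam - mu * h s) * (deviationMatrix Q π *ᵥ x))) s := by
  refine (hasDerivAt_av_mul (hs.hasDerivAt_h s) _).congr_deriv ?_
  rw [add_mul, map_add, smul_mul_assoc, map_smul, hg.av_reversal_mulVec_mul, smul_eq_mul]

lemma IsMomentSystem.hasDerivAt_av_k_mul (hs : IsMomentSystem π Q lam mu K h k)
    (hg : HasSpectralGap π Q γ) (x : Fin d → ℝ) (s : ℝ) :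
    HasDerivAt (fun s => av π (k s * (deviationMatrix Q π *ᵥ x)))
      (K * (av π (k s) * av π x - av π (k s * x))
        + av π (((2 : ℝ) • (lam * h s) - (2 : ℝ) • (mu * k s)) * (deviationMatrix Q π *ᵥ x))) s := by
  refine (hasDerivAt_av_mul (hs.hasDerivAt_k s) _).congr_deriv ?_
  rw [add_mul, map_add, smul_mul_assoc, map_smul, hg.av_reversal_mulVec_mul, smul_eq_mul]

end Single

variable {K : ℝ → ℝ} {h k : ℝ → ℝ → Fin d → ℝ}

lemma fluct_zero (π : Fin d → ℝ) : fluct π 0 = 0 := by ext i; simp [fluct_apply]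

lemma av_mul_fluct (π x y : Fin d → ℝ) : av π (x * fluct π y)
    = av π (x * y) - av π y * av π x := by
  have : x * fluct π y = x * y - av π y • x := by
    ext i; simp [fluct_apply]; ring
  rw [this, map_sub, map_smul, smul_eq_mul]

variable (hg : HasSpectralGap π Q γ) (hK : ∀ N, 1 ≤ N → 1 ≤ K N) (hmu : ∀ i, 0 ≤ mu i)
  (hs : ∀ N, 1 ≤ N → IsMomentSystem π Q lam mu (K N) (h N) (k N))

include hg hK hmu hs

lemma unifBdd_h : UnifBdd T h :=
  hg.reversal.unifBdd_of_hasDerivAt hK hmu (y₀ := 0)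
    (fun N hN s => (hs N hN).hasDerivAt_h s) (fun N hN => (hs N hN).h_zero) (unifBdd_const lam)

lemma unifBdd_k : UnifBdd T k := by
  refine hg.reversal.unifBdd_of_hasDerivAt hK (c := (2 : ℝ) • mu) (y₀ := 0)
    (g := fun N s => (2 : ℝ) • (lam * h N s)) (fun i => mul_nonneg zero_le_two (hmu i))
    (fun N hN s => ?_) (fun N hN => (hs N hN).k_zero)
    ((unifBdd_const (2 : ℝ)).smul ((unifBdd_const lam).mul (unifBdd_h hg hK hmu hs)))
  rw [smul_mul_assoc]
  exact (hs N hN).hasDerivAt_k s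

lemma unifBdd_smul_fluct_h : UnifBdd T fun N s => K N • fluct π (h N s) :=
  hg.reversal.unifBdd_smul_fluct hK (fun N hN s => (hs N hN).hasDerivAt_h s)
    (fun N hN => by rw [(hs N hN).h_zero, fluct_zero])
    ((unifBdd_const lam).sub ((unifBdd_const mu).mul (unifBdd_h hg hK hmu hs)))

lemma unifBdd_smul_fluct_k : UnifBdd T fun N s => K N • fluct π (k N s) :=
  hg.reversal.unifBdd_smul_fluct hK (fun N hN s => (hs N hN).hasDerivAt_k s)
    (fun N hN => by rw [(hs N hN).k_zero, fluct_zero])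
    (((unifBdd_const (2 : ℝ)).smul ((unifBdd_const lam).mul (unifBdd_h hg hK hmu hs))).sub
      ((unifBdd_const (2 : ℝ)).smul ((unifBdd_const mu).mul (unifBdd_k hg hK hmu hs))))

/-- The average of h solves the equation of ϱ, except that av(μh) differs from μ_∞ av h by the
average of μ against the fluctuation of h, which is O(1/K). -/
lemma unifBdd_av_h_sub_rhoI (hm : 0 < av π mu) :
    UnifBdd T fun N s => K N * (av π (h N s) - rhoI lam mu π s) := by
  have hη := unifBdd_smul_fluct_h (T := T) hg hK hmu hs
  refine unifBdd_of_hasDerivAt hm.le (g := fun N s => (-1) * av π (mu * K N • fluct π (h N s)))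
    (fun N hN s => ?_) (fun N hN => ?_)
    ((unifBdd_const (-1 : ℝ)).mul (((unifBdd_const mu).mul hη).map (av π)))
  · refine ((((hs N hN).hasDerivAt_av_h hg s).sub (hasDerivAt_rhoI hm.ne' s)).const_mul
      (K N)).congr_deriv ?_
    rw [mul_smul_comm, map_smul, smul_eq_mul, av_mul_fluct]
    ring
  · rw [(hs N hN).h_zero, rhoI_zero, map_zero, sub_zero, mul_zero]

/-- If h and k were constant in i, the difference would solve a homogeneous equation with damping
2μ_∞. Their fluctuations, of order 1/K, are its only source. -/
lemma unifBdd_variance (hm : 0 < av π mu) :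
    UnifBdd T fun N s => K N * (av π (k N s) - av π (h N s) ^ 2) := by
  have hη := unifBdd_smul_fluct_h (T := T) hg hK hmu hs
  have hψ := unifBdd_smul_fluct_k (T := T) hg hK hmu hs
  have hρ := (unifBdd_h (T := T) hg hK hmu hs).map (av π)
  refine unifBdd_of_hasDerivAt (κ := 2 * av π mu) (mul_nonneg zero_le_two hm.le)
    (g := fun N s => 2 * av π (lam * K N • fluct π (h N s))
      + 2 * (av π (h N s) * av π (mu * K N • fluct π (h N s)))
      - 2 * av π (mu * K N • fluct π (k N s)))
    (fun N hN s => ?_) (fun N hN => ?_)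
    ((((unifBdd_const (2 : ℝ)).mul (((unifBdd_const lam).mul hη).map (av π))).add
      ((unifBdd_const (2 : ℝ)).mul (hρ.mul (((unifBdd_const mu).mul hη).map (av π))))).sub
      ((unifBdd_const (2 : ℝ)).mul (((unifBdd_const mu).mul hψ).map (av π))))
  · refine ((((hs N hN).hasDerivAt_av_k hg s).sub
      (((hs N hN).hasDerivAt_av_h hg s).pow 2)).const_mul (K N)).congr_deriv ?_
    simp only [mul_smul_comm, map_smul, smul_eq_mul, av_mul_fluct]
    push_cast
    ring
  · rw [(hs N hN).h_zero, (hs N hN).k_zero, map_zero]; simp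

/-- First moments equal their limit up to the inverse speed of switching. -/
lemma unifBdd_h_sub_rhoI (hm : 0 < av π mu) :
    UnifBdd T fun N s => K N • (h N s - fun _ => rhoI lam mu π s) := by
  have h1 := ((unifBdd_av_h_sub_rhoI (T := T) hg hK hmu hs hm).smul
    (unifBdd_const (1 : Fin d → ℝ))).add (unifBdd_smul_fluct_h hg hK hmu hs)
  refine h1.congr fun N s => ?_
  ext i
  simp [fluct_apply]
  ring

/-- Second moments equal their limit up to the inverse speed of switching. -/
lemma unifBdd_k_sub_rhoI_sq (hm : 0 < av π mu) :
    UnifBdd T fun N s => K N • (k N s - fun _ => rhoI lam mu π s ^ 2) := by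
  -- Decomposition: k - ϱ² = (av k - (av h)²) + (av h - ϱ)(av h + ϱ) + the fluctuation of k.
  have h1 := (((unifBdd_variance (T := T) hg hK hmu hs hm).add
    ((unifBdd_av_h_sub_rhoI (T := T) hg hK hmu hs hm).mul
      (((unifBdd_h (T := T) hg hK hmu hs).map (av π)).add
        (unifBdd_of_continuous (continuous_rhoI lam mu π))))).smul
    (unifBdd_const (1 : Fin d → ℝ))).add (unifBdd_smul_fluct_k hg hK hmu hs)
  refine h1.congr fun N s => ?_
  ext i
  simp [fluct_apply]
  ring

/-- The leading term of the variance. -/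
theorem unifBdd_variance_sub_sigmaI (hm : 0 < av π mu) :
    UnifBdd T fun N s =>
      K N * (K N * (av π (k N s) - av π (h N s) ^ 2) - sigmaI lam mu Q π s) := by
  set yl := deviationMatrix Q π *ᵥ lam with hyl
  set ym := deviationMatrix Q π *ᵥ mu with hym
  have hyl0 : av π yl = 0 := hg.av_deviationMatrix_mulVec lam
  have hym0 : av π ym = 0 := hg.av_deviationMatrix_mulVec mu
  have hη := unifBdd_smul_fluct_h (T := T) hg hK hmu hs
  have hψ := unifBdd_smul_fluct_k (T := T) hg hK hmu hs
  have hh := unifBdd_h (T := T) hg hK hmu hs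
  have hρ := hh.map (av π)
  have hdh := unifBdd_h_sub_rhoI (T := T) hg hK hmu hs hm
  have hdk := unifBdd_k_sub_rhoI_sq (T := T) hg hK hmu hs hm
  have hdρ := unifBdd_av_h_sub_rhoI (T := T) hg hK hmu hs hm
  have hϱ : UnifBdd T fun _ s => rhoI lam mu π s :=
    unifBdd_of_continuous (continuous_rhoI lam mu π)
  have hhy : ∀ y, av π y = 0 → UnifBdd T fun N s => K N * av π (h N s * y) := by
    intro y hy
    refine ((hη.mul (unifBdd_const y)).map (av π)).congr fun N s => ?_
    rw [hg.av_mul_of_av_eq_zero _ hy, smul_mul_assoc, map_smul, smul_eq_mul]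
  have hky : ∀ y, av π y = 0 → UnifBdd T fun N s => K N * av π (k N s * y) := by
    intro y hy
    refine ((hψ.mul (unifBdd_const y)).map (av π)).congr fun N s => ?_
    rw [hg.av_mul_of_av_eq_zero _ hy, smul_mul_assoc, map_smul, smul_eq_mul]
  -- The corrector is O(1/K): Dλ and Dμ have mean zero and therefore see only fluctuations. It can
  -- be added now and subtracted at the end.
  have hcorr : UnifBdd T fun N s => 2 * (K N * av π (h N s * yl))
      + 2 * (av π (h N s) * (K N * av π (h N s * ym))) - 2 * (K N * av π (k N s * ym)) :=
    (((unifBdd_const (2 : ℝ)).mul (hhy yl hyl0)).add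
      ((unifBdd_const (2 : ℝ)).mul (hρ.mul (hhy ym hym0)))).sub
      ((unifBdd_const (2 : ℝ)).mul (hky ym hym0))
  have c1 : ∀ x : Fin d → ℝ, UnifBdd T fun N s =>
      av π (x * K N • (h N s - fun _ => rhoI lam mu π s)) := fun x =>
    ((unifBdd_const x).mul hdh).map (av π)
  have c2 : ∀ x : Fin d → ℝ, UnifBdd T fun N s =>
      av π (x * K N • (k N s - fun _ => rhoI lam mu π s ^ 2)) := fun x =>
    ((unifBdd_const x).mul hdk).map (av π)
  have c3 : UnifBdd T fun N s => 2 * ((av π lam - av π (mu * h N s)) * (K N * av π (h N s * ym))) :=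
    (unifBdd_const (2 : ℝ)).mul (((unifBdd_const _).sub
      (((unifBdd_const mu).mul hh).map (av π))).mul (hhy ym hym0))
  have c4 : UnifBdd T fun N s => av π (lam * ym) - rhoI lam mu π s * av π (mu * ym) :=
    (unifBdd_const _).sub (hϱ.mul (unifBdd_const _))
  -- In the derivative of the corrected variance all terms with the factor K cancel. Replacing h by
  -- ϱ and k by ϱ² in the rest leaves 2 `varSource`, the source of ς.
  have hW : UnifBdd T fun N s => K N * (K N * (av π (k N s) - av π (h N s) ^ 2)
      + (2 * av π (h N s * yl) + 2 * (av π (h N s) * av π (h N s * ym))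
        - 2 * av π (k N s * ym)) - sigmaI lam mu Q π s) := by
    refine unifBdd_of_hasDerivAt (κ := 2 * av π mu) (mul_nonneg zero_le_two hm.le)
      -- K times what remains: the damping acting on the corrector, the derivative of the prefactor
      -- av h in it, and the errors of replacing h by ϱ and k by ϱ².
      (g := fun N s => 2 * av π mu * (2 * (K N * av π (h N s * yl))
        + 2 * (av π (h N s) * (K N * av π (h N s * ym))) - 2 * (K N * av π (k N s * ym)))
        + 2 * ((av π lam - av π (mu * h N s)) * (K N * av π (h N s * ym)))
        + 2 * ((K N * (av π (h N s) - rhoI lam mu π s))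
          * (av π (lam * ym) - rhoI lam mu π s * av π (mu * ym)))
        - 2 * av π ((mu * yl) * K N • (h N s - fun _ => rhoI lam mu π s))
        - 2 * (av π (h N s) * av π ((mu * ym) * K N • (h N s - fun _ => rhoI lam mu π s)))
        - 4 * av π ((lam * ym) * K N • (h N s - fun _ => rhoI lam mu π s))
        + 4 * av π ((mu * ym) * K N • (k N s - fun _ => rhoI lam mu π s ^ 2)))
      (fun N hN s => ?_) (fun N hN => ?_) ?_
    · have d1 := ((hs N hN).hasDerivAt_av_k hg s).sub (((hs N hN).hasDerivAt_av_h hg s).pow 2)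
      have d2 := ((((hs N hN).hasDerivAt_av_h_mul hg lam s).const_mul 2).add
        ((((hs N hN).hasDerivAt_av_h hg s).mul
          ((hs N hN).hasDerivAt_av_h_mul hg mu s)).const_mul 2)).sub
        (((hs N hN).hasDerivAt_av_k_mul hg mu s).const_mul 2)
      refine ((((d1.const_mul (K N)).add d2).sub
        (hasDerivAt_sigmaI lam mu Q π s)).const_mul (K N)).congr_deriv ?_
      have e1 : ∀ (x y : Fin d → ℝ) (c : ℝ), av π (x * K N • (y - fun _ => c))
          = K N * (av π (x * y) - c * av π x) := by
        intro x y c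
        have : x * K N • (y - fun _ => c) = K N • (x * y - c • x) := by
          ext i; simp; ring
        rw [this, map_smul, map_sub, map_smul]; rfl
      have e2 : ∀ y : Fin d → ℝ, av π ((lam - mu * h N s) * y)
          = av π (lam * y) - av π ((mu * y) * h N s) := by
        intro y
        rw [sub_mul, map_sub, mul_right_comm]
      have e3 : av π (((2 : ℝ) • (lam * h N s) - (2 : ℝ) • (mu * k N s)) * ym)
          = 2 * av π ((lam * ym) * h N s) - 2 * av π ((mu * ym) * k N s) := by
        rw [sub_mul, map_sub, smul_mul_assoc, smul_mul_assoc, map_smul, map_smul,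
          mul_right_comm lam, mul_right_comm mu]
        rfl
      have e4 : varSource lam mu Q π s = av π (lam * yl) - rhoI lam mu π s * av π (lam * ym)
          - rhoI lam mu π s * av π (mu * yl) + rhoI lam mu π s ^ 2 * av π (mu * ym) := by
        have : (lam - rhoI lam mu π s • mu) * (deviationMatrix Q π *ᵥ (lam - rhoI lam mu π s • mu))
            = lam * yl - rhoI lam mu π s • (lam * ym) - rhoI lam mu π s • (mu * yl)
              + rhoI lam mu π s ^ 2 • (mu * ym) := by
          rw [Matrix.mulVec_sub, Matrix.mulVec_smul, ← hyl, ← hym]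
          ext i
          simp
          ring
        rw [varSource, this]
        simp only [map_add, map_sub, map_smul, smul_eq_mul]
      simp only [← hyl, ← hym, e1, e2, e3, e4, mul_comm (h N s) lam, mul_comm (h N s) mu,
        mul_comm (k N s) mu]
      push_cast
      ring
    · rw [(hs N hN).h_zero, (hs N hN).k_zero, sigmaI_zero, map_zero]; simp
    · exact ((((((((unifBdd_const _).mul hcorr).add c3).add
        ((unifBdd_const (2 : ℝ)).mul (hdρ.mul c4))).sub
        ((unifBdd_const (2 : ℝ)).mul (c1 _))).sub
        ((unifBdd_const (2 : ℝ)).mul (hρ.mul (c1 _)))).sub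
        ((unifBdd_const (4 : ℝ)).mul (c1 _))).add
        ((unifBdd_const (4 : ℝ)).mul (c2 _)))
  refine (hW.sub hcorr).congr fun N s => ?_
  ring

end MomentSystem

/-! ### Conditional means under fast switching -/

section MeanSystem

variable {d : ℕ} {Q : Matrix (Fin d) (Fin d) ℝ} {π lam mu : Fin d → ℝ} {γ T : ℝ}
  {K : ℝ → ℝ} {b a : ℝ → ℝ → Fin d → ℝ}

variable (hg : HasSpectralGap π Q γ) (hK : ∀ N, 1 ≤ N → 1 ≤ K N) (hmu : ∀ i, 0 ≤ mu i)
  (hs : ∀ N, 1 ≤ N → IsMeanSystem Q lam mu (K N) (b N) (a N))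

include hg hK hmu hs

lemma unifBdd_b : UnifBdd T b :=
  hg.unifBdd_of_hasDerivAt hK hmu (y₀ := 1) (g := fun _ _ => 0)
    (fun N hN s => by rw [zero_sub]; exact (hs N hN).hasDerivAt_b s) (fun N hN => (hs N hN).b_zero)
    (unifBdd_const 0)

lemma unifBdd_smul_fluct_b : UnifBdd T fun N s => K N • fluct π (b N s) :=
  hg.unifBdd_smul_fluct hK (fun N hN s => (hs N hN).hasDerivAt_b s)
    (fun N hN => by
      rw [(hs N hN).b_zero]; ext i
      rw [fluct_apply, Pi.one_def, hg.av_const, sub_self]; rfl)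
    (((unifBdd_const (0 : Fin d → ℝ)).sub ((unifBdd_const mu).mul
      (unifBdd_b hg hK hmu hs))).congr fun N s => by rw [zero_sub])

lemma unifBdd_smul_fluct_a : UnifBdd T fun N s => K N • fluct π (a N s) :=
  hg.unifBdd_smul_fluct hK (fun N hN s => (hs N hN).hasDerivAt_a s)
    (fun N hN => by rw [(hs N hN).a_zero, fluct_zero])
    ((unifBdd_const lam).mul (unifBdd_b hg hK hmu hs))

/-- A tagged job sees the averaged hazard rate μ_∞ up to the fluctuation of b, which is O(1/K). -/
lemma unifBdd_av_b_sub_exp (hm : 0 < av π mu) :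
    UnifBdd T fun N s => K N * (av π (b N s) - Real.exp (-(av π mu) * s)) := by
  have hb := unifBdd_smul_fluct_b (T := T) hg hK hmu hs
  refine unifBdd_of_hasDerivAt hm.le (g := fun N s => (-1) * av π (mu * K N • fluct π (b N s)))
    (fun N hN s => ?_) (fun N hN => ?_)
    ((unifBdd_const (-1 : ℝ)).mul (((unifBdd_const mu).mul hb).map (av π)))
  · have h1 : HasDerivAt (fun s : ℝ => Real.exp (-(av π mu) * s))
        (Real.exp (-(av π mu) * s) * -(av π mu)) s := by
      simpa using ((hasDerivAt_id s).const_mul (-(av π mu))).exp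
    refine (((hasDerivAt_av ((hs N hN).hasDerivAt_b s)).sub h1).const_mul (K N)).congr_deriv ?_
    rw [map_add, map_smul, hg.av_mulVec, mul_smul_comm, map_smul, smul_eq_mul, smul_eq_mul,
      av_mul_fluct, map_neg]
    ring
  · rw [(hs N hN).b_zero, Pi.one_def, hg.av_const]; simp

end MeanSystem

/-! ### The scaled model -/

section Scaling

variable {d : ℕ} {Q : Matrix (Fin d) (Fin d) ℝ} {π : Fin d → ℝ} {γ : ℝ}

lemma IsRateMatrix.smul (hQ : IsRateMatrix Q) {K : ℝ} (hK : 0 ≤ K) : IsRateMatrix (K • Q) where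
  off_diag_nonneg i j hij := mul_nonneg hK (hQ.off_diag_nonneg i j hij)
  row_sum i := by
    simp only [Matrix.smul_apply, smul_eq_mul, ← Finset.mul_sum, hQ.row_sum, mul_zero]

lemma IsInvariantProb.smul (hπ : IsInvariantProb Q π) (K : ℝ) : IsInvariantProb (K • Q) π where
  nonneg := hπ.nonneg
  sum_eq_one := hπ.sum_eq_one
  invariant := by rw [Matrix.vecMul_smul, hπ.invariant, smul_zero]

variable (lam mu : Fin d → ℝ) (Q π)

/-- First moments in the scaled model, relative to `N π`. -/
def scaledFirst (N K s : ℝ) (i : Fin d) : ℝ :=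
  momentRow (N • lam) mu (K • Q) π s (1, i) / (N * π i)

/-- Second factorial moments in the scaled model, relative to `N² π`. -/
def scaledSecond (N K s : ℝ) (i : Fin d) : ℝ :=
  momentRow (N • lam) mu (K • Q) π s (2, i) / (N ^ 2 * π i)

/-- Conditional mean of the number of jobs that survive from one job initially. -/
def scaledSlope (N K s : ℝ) (i : Fin d) : ℝ :=
  meanColumn (N • lam) mu (K • Q) s (1, i)

/-- Conditional mean of the number of jobs for an initially empty system, relative to `N`. -/
def scaledIntercept (N K s : ℝ) (i : Fin d) : ℝ :=
  meanColumn (N • lam) mu (K • Q) s (0, i) / N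

variable {Q π}

/-- Division by π_i turns the transposed action of Q into the reversed generator. Each order of
moment takes one factor N, matching the arrival rates Nλ that link consecutive orders. -/
lemma isMomentSystem_scaled (hg : HasSpectralGap π Q γ) (hπ : IsInvariantProb Q π) {N : ℝ}
    (hN : 0 < N) (K : ℝ) :
    IsMomentSystem π Q lam mu K (scaledFirst Q π lam mu N K) (scaledSecond Q π lam mu N K) := by
  have hN0 := hN.ne'
  refine ⟨?_, ?_, fun s => hasDerivAt_pi.2 fun i => ?_, fun s => hasDerivAt_pi.2 fun i => ?_⟩
  · ext i; simp [scaledFirst, momentRow_zero, initialRow]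
  · ext i; simp [scaledSecond, momentRow_zero, initialRow]
  · have hi := (hg.pos i).ne'
    have h1 := (hasDerivAt_momentRow (N • lam) mu (K • Q) π s (1, i)).div_const (N * π i)
    rw [vecMul_momentMatrix_one, momentRow_apply_zero _ _ _ (hπ.smul K).invariant] at h1
    refine h1.congr_deriv ?_
    have h2 : ∑ j, momentRow (N • lam) mu (K • Q) π s (1, j) * (K • Q) j i
        = N * π i * (K * ∑ j, reversedRates π Q i j * scaledFirst Q π lam mu N K s j) := by
      simp only [Finset.mul_sum]
      refine Finset.sum_congr rfl fun j _ => ?_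
      have hj := (hg.pos j).ne'
      simp only [scaledFirst, reversedRates, Matrix.smul_apply, smul_eq_mul]
      field_simp
    rw [h2]
    simp only [Pi.add_apply, Pi.sub_apply, Pi.mul_apply, Pi.smul_apply, smul_eq_mul, Matrix.mulVec,
      dotProduct, scaledFirst]
    field_simp
    ring
  · have hi := (hg.pos i).ne'
    have h1 := (hasDerivAt_momentRow (N • lam) mu (K • Q) π s (2, i)).div_const (N ^ 2 * π i)
    rw [vecMul_momentMatrix_two] at h1
    refine h1.congr_deriv ?_
    have h2 : ∑ j, momentRow (N • lam) mu (K • Q) π s (2, j) * (K • Q) j i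
        = N ^ 2 * π i * (K * ∑ j, reversedRates π Q i j * scaledSecond Q π lam mu N K s j) := by
      simp only [Finset.mul_sum]
      refine Finset.sum_congr rfl fun j _ => ?_
      have hj := (hg.pos j).ne'
      simp only [scaledSecond, reversedRates, Matrix.smul_apply, smul_eq_mul]
      field_simp
    rw [h2]
    simp only [Pi.add_apply, Pi.sub_apply, Pi.mul_apply, Pi.smul_apply, smul_eq_mul, Matrix.mulVec,
      dotProduct, scaledFirst, scaledSecond]
    field_simp
    ring

lemma isMeanSystem_scaled {N : ℝ} (hN : 0 < N) (K : ℝ) :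
    IsMeanSystem Q lam mu K (scaledSlope Q lam mu N K) (scaledIntercept Q lam mu N K) := by
  have hN0 := hN.ne'
  refine ⟨?_, ?_, fun s => hasDerivAt_pi.2 fun i => ?_, fun s => hasDerivAt_pi.2 fun i => ?_⟩
  · ext i; simp [scaledSlope, meanColumn_zero, jobsColumn]
  · ext i; simp [scaledIntercept, meanColumn_zero, jobsColumn]
  · have h1 := hasDerivAt_meanColumn (N • lam) mu (K • Q) s (1, i)
    rw [momentMatrix_mulVec_one, meanColumn_apply_two] at h1
    refine h1.congr_deriv ?_
    simp only [Pi.add_apply, Pi.neg_apply, Pi.mul_apply, Pi.smul_apply, smul_eq_mul, Matrix.mulVec,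
      dotProduct, scaledSlope, Matrix.smul_apply, Finset.mul_sum, mul_assoc]
    ring
  · have h1 := (hasDerivAt_meanColumn (N • lam) mu (K • Q) s (0, i)).div_const N
    rw [momentMatrix_mulVec_zero] at h1
    refine h1.congr_deriv ?_
    have h2 : ∑ j, (K • Q) i j * meanColumn (N • lam) mu (K • Q) s (0, j)
        = N * (K * ∑ j, Q i j * scaledIntercept Q lam mu N K s j) := by
      simp only [Finset.mul_sum]
      refine Finset.sum_congr rfl fun j _ => ?_
      simp only [scaledIntercept, Matrix.smul_apply, smul_eq_mul]
      field_simp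
    rw [h2]
    simp only [Pi.add_apply, Pi.mul_apply, Pi.smul_apply, smul_eq_mul, Matrix.mulVec,
      dotProduct, scaledSlope]
    field_simp

variable {lam mu}

/-- The covariance in the scaled model, separated into a contribution of order `N` and one of
order `N² / K`. -/
lemma covariance_scaled (hQ : IsRateMatrix Q) (hg : HasSpectralGap π Q γ)
    (hπ : IsInvariantProb Q π) (hlam : ∀ i, 0 ≤ lam i) (hmu : ∀ i, 0 ≤ mu i)
    {Ω : Type*} [MeasurableSpace Ω] {Pr : Measure Ω} [IsProbabilityMeasure Pr]
    {J : ℝ≥0 → Ω → Fin d} {M : ℝ≥0 → Ω → ℕ} {N K : ℝ} (hN : 0 < N) (hK : 0 ≤ K)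
    (hM : IsModelI (N • lam) mu (K • Q) π Pr J M) (t u : ℝ≥0) {h k b a : Fin d → ℝ}
    (hh : h = scaledFirst Q π lam mu N K t) (hk : k = scaledSecond Q π lam mu N K t)
    (hb : b = scaledSlope Q lam mu N K u) (ha : a = scaledIntercept Q lam mu N K u) :
    covariance (fun ω => (M t ω : ℝ)) (fun ω => (M (t + u) ω : ℝ)) Pr
      = N * (av π h * av π b + av π (fluct π h * fluct π b))
        + N ^ 2 * ((av π k - av π h ^ 2) * av π b + av π (fluct π k * fluct π b)
          - av π h * av π (fluct π h * fluct π b) + av π (fluct π h * fluct π a)) := by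
  rw [IsModelI.covariance_eq (lam := N • lam) (hQ.smul hK) (fun i => mul_nonneg hN.le (hlam i)) hmu (hπ.smul K) hM]
  have e1 : ∀ i, momentRow (N • lam) mu (K • Q) π t (1, i) = N * (π i * h i) := fun i => by
    have hi := (hg.pos i).ne'
    rw [hh, scaledFirst]
    field_simp
  have e2 : ∀ i, momentRow (N • lam) mu (K • Q) π t (2, i) = N ^ 2 * (π i * k i) := fun i => by
    have hi := (hg.pos i).ne'
    rw [hk, scaledSecond]
    field_simp
  have e3 : ∀ i, meanColumn (N • lam) mu (K • Q) u (1, i) = b i := fun i => by rw [hb]; rfl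
  have e4 : ∀ i, meanColumn (N • lam) mu (K • Q) u (0, i) = N * a i := fun i => by
    rw [ha, scaledIntercept]
    field_simp
  simp only [e1, e2, e3, e4]
  have f1 : ∑ i, (N * (π i * h i) + N ^ 2 * (π i * k i)) * b i
      = N * av π (h * b) + N ^ 2 * av π (k * b) := by
    simp only [av_apply, Finset.mul_sum, ← Finset.sum_add_distrib, Pi.mul_apply]
    exact Finset.sum_congr rfl fun i _ => by ring
  have f2 : ∑ i, N * (π i * h i) * (N * a i) = N ^ 2 * av π (h * a) := by
    simp only [av_apply, Finset.mul_sum, Pi.mul_apply]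
    exact Finset.sum_congr rfl fun i _ => by ring
  have f3 : ∑ i, N * (π i * h i) = N * av π h := by
    rw [av_apply, Finset.mul_sum]
  have f4 : ∑ i, N * (π i * h i) * b i = N * av π (h * b) := by
    simp only [av_apply, Finset.mul_sum, Pi.mul_apply]
    exact Finset.sum_congr rfl fun i _ => by ring
  have f5 : ∑ i, π i * (N * a i) = N * av π a := by
    simp only [av_apply, Finset.mul_sum]
    exact Finset.sum_congr rfl fun i _ => by ring
  -- Splitting each average of a product makes N² (av h)(av a) cancel, so a enters only through its
  -- fluctuation.
  rw [f1, f2, f3, f4, f5, hg.av_mul_eq h b, hg.av_mul_eq k b, hg.av_mul_eq h a]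
  ring

end Scaling

/-! ### Passage to the limit -/

section Tendsto

variable {E : Type*} {T : ℝ} {K : ℝ → ℝ}

lemma UnifBdd.isBoundedUnder [Norm E] {f : ℝ → ℝ → E} (hf : UnifBdd T f) {s : ℝ}
    (hs : s ∈ Set.Icc 0 T) : IsBoundedUnder (· ≤ ·) atTop (norm ∘ fun N => f N s) := by
  obtain ⟨C, hC⟩ := hf
  exact isBoundedUnder_of_eventually_le (a := C)
    ((eventually_ge_atTop 1).mono fun N hN => hC N hN s hs)

lemma UnifBdd.tendsto_zero [SeminormedAddCommGroup E] [NormedSpace ℝ E] (hK : Tendsto K atTop atTop)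
    {f : ℝ → ℝ → E} (hf : UnifBdd T fun N s => K N • f N s) {s : ℝ} (hs : s ∈ Set.Icc 0 T) :
    Tendsto (fun N => f N s) atTop (𝓝 0) := by
  obtain ⟨C, hC⟩ := hf
  refine squeeze_zero_norm' ?_ ((tendsto_const_nhds (x := C)).div_atTop hK)
  filter_upwards [eventually_ge_atTop 1, hK.eventually_gt_atTop 0] with N hN hKN
  rw [le_div_iff₀ hKN, mul_comm]
  have := hC N hN s hs
  rwa [norm_smul, Real.norm_eq_abs, abs_of_pos hKN] at this

/-- As e ≤ 0, the condition 0 ≤ e means e = 0; this is how the indicators in α arise. -/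
lemma tendsto_rpow_of_nonpos {e : ℝ} (he : e ≤ 0) :
    Tendsto (fun N : ℝ => N ^ e) atTop (𝓝 (if 0 ≤ e then 1 else 0)) := by
  split_ifs with h
  · rw [le_antisymm he h]
    simp
  · simpa using tendsto_rpow_neg_atTop (y := -e) (by linarith)

end Tendsto

end MMInfServer

open MMInfServer in
theorem mainTheorem3 {d : ℕ} (Q : Matrix (Fin d) (Fin d) ℝ)
    (hQ : MMInfServer.IsRateMatrix Q) (hirr : MMInfServer.IsIrreducibleRate Q)
    (π : Fin d → ℝ) (hπ : MMInfServer.IsInvariantProb Q π)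
    (lam mu : Fin d → ℝ) (hlam : ∀ i, 0 ≤ lam i) (hmu : ∀ i, 0 ≤ mu i)
    (hmuInf : 0 < π ⬝ᵥ mu)
    (α : ℝ) (hα : 0 < α)
    {Ω : ℝ → Type*} [∀ N, MeasurableSpace (Ω N)]
    (Pr : ∀ N, Measure (Ω N)) [∀ N, IsProbabilityMeasure (Pr N)]
    (J : ∀ N, ℝ≥0 → Ω N → Fin d) (M : ∀ N, ℝ≥0 → Ω N → ℕ)
    (hM : ∀ N : ℝ, 0 < N →
      MMInfServer.IsModelI (N • lam) mu (N ^ α • Q) π (Pr N) (J N) (M N))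
    (t u : ℝ≥0) :
    (∀ N : ℝ, 0 < N → ∀ s : ℝ≥0, MemLp (fun ω => (M N s ω : ℝ)) 2 (Pr N)) ∧
    (∀ i j, IntegrableOn (fun r : ℝ => MMInfServer.transProb Q r i j - π j) (Set.Ioi 0)) ∧
    Tendsto
      (fun N : ℝ =>
        covariance (fun ω => (M N t ω : ℝ)) (fun ω => (M N (t + u) ω : ℝ)) (Pr N)
          / N ^ max 1 (2 - α))
      atTop (𝓝 (MMInfServer.vI lam mu Q π α t u)) := by
  obtain ⟨γ, hg⟩ := exists_hasSpectralGap hQ hirr hπ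
  refine ⟨fun N hN s => (hM N hN).memLp_two (hQ.smul (Real.rpow_nonneg hN.le α))
    (fun i => mul_nonneg hN.le (hlam i)) hmu hπ.sum_eq_one s,
    hg.integrableOn_transProb_sub, ?_⟩
  have hm : 0 < av π mu := by rwa [← dotProduct_eq_av]
  set K : ℝ → ℝ := fun N => N ^ α with hKdef
  have hK : ∀ N, 1 ≤ N → 1 ≤ K N := fun N hN => Real.one_le_rpow hN hα.le
  have hKtop : Tendsto K atTop atTop := tendsto_rpow_atTop hα
  set h : ℝ → ℝ → Fin d → ℝ := fun N => scaledFirst Q π lam mu N (K N) with hh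
  set k : ℝ → ℝ → Fin d → ℝ := fun N => scaledSecond Q π lam mu N (K N) with hk
  set b : ℝ → ℝ → Fin d → ℝ := fun N => scaledSlope Q lam mu N (K N) with hb
  set a : ℝ → ℝ → Fin d → ℝ := fun N => scaledIntercept Q lam mu N (K N) with ha
  have hs : ∀ N, 1 ≤ N → IsMomentSystem π Q lam mu (K N) (h N) (k N) := fun N hN =>
    isMomentSystem_scaled lam mu hg hπ (zero_lt_one.trans_le hN) (K N)
  have hs' : ∀ N, 1 ≤ N → IsMeanSystem Q lam mu (K N) (b N) (a N) := fun N hN =>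
    isMeanSystem_scaled lam mu (zero_lt_one.trans_le hN) (K N)
  have ht : (t : ℝ) ∈ Set.Icc (0 : ℝ) t := ⟨t.coe_nonneg, le_rfl⟩
  have hu : (u : ℝ) ∈ Set.Icc (0 : ℝ) u := ⟨u.coe_nonneg, le_rfl⟩
  have lρ : Tendsto (fun N => av π (h N t)) atTop (𝓝 (rhoI lam mu π t)) :=
    tendsto_sub_nhds_zero_iff.1
      ((unifBdd_av_h_sub_rhoI hg hK hmu hs hm).tendsto_zero hKtop ht)
  have lβ : Tendsto (fun N => av π (b N u)) atTop (𝓝 (Real.exp (-(av π mu) * u))) :=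
    tendsto_sub_nhds_zero_iff.1
      ((unifBdd_av_b_sub_exp hg hK hmu hs' hm).tendsto_zero hKtop hu)
  have lv : Tendsto (fun N => K N * (av π (k N t) - av π (h N t) ^ 2)) atTop
      (𝓝 (sigmaI lam mu Q π t)) :=
    tendsto_sub_nhds_zero_iff.1
      ((unifBdd_variance_sub_sigmaI hg hK hmu hs hm).tendsto_zero hKtop ht)
  have lb : Tendsto (fun N => fluct π (b N u)) atTop (𝓝 0) :=
    (unifBdd_smul_fluct_b hg hK hmu hs').tendsto_zero hKtop hu
  have la : Tendsto (fun N => fluct π (a N u)) atTop (𝓝 0) :=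
    (unifBdd_smul_fluct_a hg hK hmu hs').tendsto_zero hKtop hu
  have lh : Tendsto (fun N => fluct π (h N t)) atTop (𝓝 0) :=
    (unifBdd_smul_fluct_h hg hK hmu hs).tendsto_zero hKtop ht
  -- The terms of order N² are written as N²/K times K. One fluctuation absorbs the factor K and
  -- stays bounded, while the other factor tends to zero.
  have bh := (unifBdd_smul_fluct_h hg hK hmu hs).isBoundedUnder ht
  have bk := (unifBdd_smul_fluct_k hg hK hmu hs).isBoundedUnder ht
  have lav : ∀ {x : ℝ → Fin d → ℝ}, Tendsto x atTop (𝓝 0) →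
      Tendsto (fun N => av π (x N)) atTop (𝓝 0) := fun {x} hx => by
    have := ((av π).continuous.tendsto 0).comp hx
    rwa [map_zero] at this
  have lhb := lav (by simpa using lh.mul lb)
  have lkb := lav (isBoundedUnder_le_mul_tendsto_zero bk lb)
  have lhb' := lav (isBoundedUnder_le_mul_tendsto_zero bh lb)
  have lha := lav (isBoundedUnder_le_mul_tendsto_zero bh la)
  -- Exponents of N and of N²/K after normalisation: the first is zero exactly for α ≥ 1, the second
  -- exactly for α ≤ 1.
  have hmax1 : 1 - max 1 (2 - α) ≤ 0 := by linarith [le_max_left 1 (2 - α)]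
  have hmax2 : 2 - α - max 1 (2 - α) ≤ 0 := by linarith [le_max_right 1 (2 - α)]
  have key := ((tendsto_rpow_of_nonpos hmax2).mul
    (((lv.mul lβ).add lkb).sub (lρ.mul lhb') |>.add lha)).add
    ((tendsto_rpow_of_nonpos hmax1).mul ((lρ.mul lβ).add lhb))
  have hlim : vI lam mu Q π α t u
      = (if 0 ≤ 2 - α - max 1 (2 - α) then 1 else 0)
        * (sigmaI lam mu Q π t * Real.exp (-(av π mu) * u) + 0 - rhoI lam mu π t * 0 + 0)
        + (if 0 ≤ 1 - max 1 (2 - α) then 1 else 0)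
          * (rhoI lam mu π t * Real.exp (-(av π mu) * u) + 0) := by
    have i1 : 0 ≤ 2 - α - max 1 (2 - α) ↔ α ≤ 1 := by
      rw [sub_nonneg, max_le_iff]; constructor
      · intro h; linarith [h.1]
      · intro h; exact ⟨by linarith, le_rfl⟩
    have i2 : 0 ≤ 1 - max 1 (2 - α) ↔ 1 ≤ α := by
      rw [sub_nonneg, max_le_iff]; constructor
      · intro h; linarith [h.2]
      · intro h; exact ⟨le_rfl, by linarith⟩
    simp only [i1, i2, vI, dotProduct_eq_av]
    split_ifs <;> ring
  rw [hlim]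
  refine key.congr' ?_
  filter_upwards [eventually_ge_atTop 1] with N hN
  have hN0 : 0 < N := zero_lt_one.trans_le hN
  have hKN : 0 < K N := zero_lt_one.trans_le (hK N hN)
  rw [covariance_scaled hQ hg hπ hlam hmu hN0 hKN.le (hM N hN0) t u (h := h N t) (k := k N t)
    (b := b N u) (a := a N u) rfl rfl rfl rfl]
  have p1 : N ^ (1 - max 1 (2 - α)) = N / N ^ max 1 (2 - α) := by
    rw [Real.rpow_sub hN0, Real.rpow_one]
  have p2 : N ^ (2 - α - max 1 (2 - α)) = N ^ 2 / K N / N ^ max 1 (2 - α) := by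
    rw [Real.rpow_sub hN0, Real.rpow_sub hN0, Real.rpow_two]
  have p3 : 0 < N ^ max 1 (2 - α) := Real.rpow_pos_of_pos hN0 _
  rw [p1, p2]
  simp only [smul_mul_assoc, map_smul, smul_eq_mul]
  field_simp
  ring
end
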